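/- Notation. Rows $[z(D)\,|\,x(D)]$ of $2N$ binary Laurent polynomials describe, up to phase, finite-weight Pauli sequences on a stream of frames of $N$ qubits: the coefficient of $D^t$ in $z_q$ (in $x_q$) is the exponent of $Z$ (of $X$) on qubit $q$ of frame $t$; infinite-weight sequences have entries in $\mathbb F_2(D)$. Two finite-weight sequences commute with all shifts of each other iff their shifted symplectic product $z(D)\cdot x'(D^{-1})+x(D)\cdot z'(D^{-1})$ vanishes. The *finite-depth* shift-invariant Clifford operations, repeated in every frame, are: CNOT from qubit $i$ to qubit $j\ne i$ in a frame delayed by $k\in\mathbb Z$; Hadamard; phase gate; controlled-phase from qubit $i$ to qubit $j$ (or to $i$ itself, $k\neq 0$) in a frame delayed by $k$; delay of a qubit by $l\in\mathbb Z$ frames. An *infinite-depth* operation $1/f(D)$ on qubit $i$, with $f\in\mathbb F_2[D]$, $f(0)=1$, multiplies $x_i$ by $1/f(D)$ and $z_i$ by $f(D^{-1})$; it is performed online by a running cascade of CNOTs from earlier frames into the present one. A circuit is a finite list of such operations. An $[[n,k;c]]$ entanglement-assisted quantum convolutional code starts, in each frame, from $c$ ebits shared by sender and receiver (stabilized by $ZZ$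 and $XX$), and $n-k-c$ ancilla qubits (stabilized by $Z$) and $k$ information qubits of the sender, who thus holds $n$ qubits per frame. The sender applies an online encoding circuit of the above operations to her $n$ qubits only. The receiver, holding all $n+c$ qubits, applies a decoding circuit of finite-depth operations only; encoding followed by decoding takes the operators $Z$ and $X$ of each information qubit to the operators $Z$ and $X$ of an output qubit, up to multiplication by finite products of shifted generators of the decoded stabilizer. The code *realizes* a quantum check matrix $H(D)$ with $2n$ columns if there are finite-weight Pauli sequences on the $c+n$ qubits per frame, with vanishing mutual shifted symplectic products, whose parts on the sender's qubits are the rows of $H(D)$, and which arise from the encoded stabilizer generators by a matrix $R(D)$ of Laurent polynomials that is invertible over $\mathbb F_2(D)$. Theorem. Let $k_1,k_2\le n$ and let $H_1(D)$, $H_2(D)$ be binary polynomial matrices of sizes $(n-k_1)\times n$ and $(n-k_2)\times n$, check matrices of two classical binary convolutional codes, each of them noncatastrophic (if $u(D)H_i(D)$ has finite weight for a row $u(D)$ of power series, then $u(D)$ has finite weight) and delay-free ($H_i(0)$ has full row rank). Let $c$ be the rank of $H_1(D)H_2^T(D^{-1})$ over $\mathbb F_2(D)$. Then $k_1+k_2-n+c\ge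 0$, and there is an $[[n,\,k_1+k_2-n+c;\,c]]$ entanglement-assisted quantum convolutional code, with an online encoding circuit of finite-depth and possibly infinite-depth operations and a finite-depth decoding circuit, that realizes the CSS quantum check matrix $$\left[\begin{array}{c|c} H_1(D) & 0\\ 0 & H_2(D)\end{array}\right].$$ If moreover $H_1(D)H_2^T(D^{-1})=A(D)\begin{bmatrix}\Gamma(D)&0\\0&0\end{bmatrix}B(D)$ with $A(D),B(D)$ invertible over the binary Laurent polynomials and $\Gamma(D)$ a $c\times c$ diagonal matrix of powers of $D$, then such a code exists whose encoding circuit has finite-depth operations only. -/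

import Mathlib

open scoped Polynomial LaurentPolynomial

noncomputable section

namespace EAQC

/-- Binary Laurent polynomials in the delay `D` (written `T` in Mathlib). A Laurent polynomial is
a finite-weight binary sequence indexed by the frames `t ∈ ℤ`. -/
abbrev BLaurent : Type := (ZMod 2)[T;T⁻¹]

/-- Binary rational functions in the delay `D`. -/
abbrev BRat : Type := FractionRing BLaurent

/-- The inclusion of Laurent polynomials into rational functions. -/
def toRat : BLaurent →+* BRat := algebraMap BLaurent BRat

/-- The power `D ^ l`, for `l ∈ ℤ`, as a rational function. -/
def delayPow (l : ℤ) : BRat := toRat (LaurentPolynomial.T l)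

/-! ### Classical convolutional codes -/

/-- A polynomial matrix `H(D)` is noncatastrophic if an input stream `u(D)` (a row of power series)
whose output `u(D) H(D)` has finite weight has finite weight itself. -/
def Noncatastrophic {r n : ℕ} (H : Matrix (Fin r) (Fin n) (ZMod 2)[X]) : Prop :=
  ∀ u : Fin r → PowerSeries (ZMod 2),
    (∀ j, ∃ p : (ZMod 2)[X], (p : PowerSeries (ZMod 2)) =
      ∑ i, u i * (H i j : PowerSeries (ZMod 2))) →
    ∀ i, ∃ p : (ZMod 2)[X], (p : PowerSeries (ZMod 2)) = u i

/-- A polynomial matrix `H(D)` is delay-free if `H(0)` has full row rank. -/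
def DelayFree {r n : ℕ} (H : Matrix (Fin r) (Fin n) (ZMod 2)[X]) : Prop :=
  LinearIndependent (ZMod 2) fun i : Fin r => fun j : Fin n => (H i j).coeff 0

/-- `H(D)` as a matrix of Laurent polynomials. -/
def toLaurentMatrix {r n : ℕ} (H : Matrix (Fin r) (Fin n) (ZMod 2)[X]) :
    Matrix (Fin r) (Fin n) BLaurent :=
  H.map Polynomial.toLaurent

/-- The matrix `H₁(D) H₂ᵀ(D⁻¹)`. -/
def overlap {r₁ r₂ n : ℕ} (H₁ : Matrix (Fin r₁) (Fin n) (ZMod 2)[X])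
    (H₂ : Matrix (Fin r₂) (Fin n) (ZMod 2)[X]) : Matrix (Fin r₁) (Fin r₂) BLaurent :=
  toLaurentMatrix H₁ * ((toLaurentMatrix H₂).map LaurentPolynomial.invert).transpose

/-- The rank of a matrix of Laurent polynomials over the field of rational functions. -/
def ratRank {r₁ r₂ : ℕ} (P : Matrix (Fin r₁) (Fin r₂) BLaurent) : ℕ :=
  (P.map toRat).rank

/-- The `r₁ × r₂` matrix `diag(Γ(D), 0)` where `Γ(D)` is the `c × c` diagonal matrix with the
powers `D ^ (e 0), …, D ^ (e (c - 1))` of `D` on its diagonal. -/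
def monomialDiagonal (r₁ r₂ c : ℕ) (e : ℕ → ℤ) : Matrix (Fin r₁) (Fin r₂) BLaurent :=
  fun i j => if i.val = j.val ∧ i.val < c then LaurentPolynomial.T (e i.val) else 0

/-- `P(D) = A(D) diag(Γ(D), 0) B(D)` with `A(D)`, `B(D)` invertible over the Laurent polynomials
and `Γ(D)` a `c × c` diagonal matrix whose diagonal entries are powers of `D`. -/
def HasMonomialSmithForm {r₁ r₂ : ℕ} (P : Matrix (Fin r₁) (Fin r₂) BLaurent) (c : ℕ) : Prop :=
  ∃ (A : Matrix (Fin r₁) (Fin r₁) BLaurent) (B : Matrix (Fin r₂) (Fin r₂) BLaurent)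
    (e : ℕ → ℤ), IsUnit A ∧ IsUnit B ∧
    P = A * monomialDiagonal r₁ r₂ c e * B

/-! ### Pauli sequences and their commutation relations

`Q` is the set of qubits of one frame. A phase-free Pauli sequence on a stream of frames is a row
`[z(D) | x(D)]`: the coefficient of `D ^ t` in the entry `Sum.inl q` (resp. `Sum.inr q`) is the
exponent of the Pauli matrix `Z` (resp. `X`) on qubit `q` of frame `t`. Finite-weight sequences have
Laurent polynomial entries; the infinite-weight sequences that arise from infinite-depth operations
have rational entries. Products of Pauli sequences are sums of rows, and delaying a sequence by `l`
frames multiplies its row by `D ^ l`. -/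

/-- A (possibly infinite-weight) phase-free Pauli sequence. -/
abbrev PauliRow (Q : Type) : Type := Q ⊕ Q → BRat

/-- The shifted symplectic product `z(D)·x'(D⁻¹) + x(D)·z'(D⁻¹)` of two finite-weight Pauli
sequences. The coefficient of `D ^ t` is nonzero exactly when the first sequence anticommutes with
the second one delayed by `t` frames. -/
def shiftedSymp {Q : Type} [Fintype Q] (u v : Q ⊕ Q → BLaurent) : BLaurent :=
  ∑ q, (u (Sum.inl q) * LaurentPolynomial.invert (v (Sum.inr q)) +
    u (Sum.inr q) * LaurentPolynomial.invert (v (Sum.inl q)))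

/-- The Pauli matrix `Z` on qubit `q` of frame `0`. -/
def pauliZ {Q : Type} [DecidableEq Q] (q : Q) : PauliRow Q := Pi.single (Sum.inl q) 1

/-- The Pauli matrix `X` on qubit `q` of frame `0`. -/
def pauliX {Q : Type} [DecidableEq Q] (q : Q) : PauliRow Q := Pi.single (Sum.inr q) 1

/-! ### Shift-invariant Clifford operations -/

/-- Shift-invariant Clifford operations on a stream of frames with qubits `Q`; each of them is
repeated in every frame. -/
inductive Gate (Q : Type) : Type
  /-- CNOT from qubit `i` to qubit `j` in a frame delayed by `k`. -/
  | cnot (i j : Q) (k : ℤ) (h : i ≠ j)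
  /-- Hadamard gate on qubit `i`. -/
  | hadamard (i : Q)
  /-- Phase gate on qubit `i`. -/
  | phase (i : Q)
  /-- Controlled-phase gate from qubit `i` to qubit `j` in a frame delayed by `k`. -/
  | cphase (i j : Q) (k : ℤ) (h : i ≠ j)
  /-- Controlled-phase gate from qubit `i` to qubit `i` in a frame delayed by `k`. -/
  | cphaseSelf (i : Q) (k : ℤ) (h : k ≠ 0)
  /-- Delay (or advance) the processing of qubit `i` by `l` frames. -/
  | delay (i : Q) (l : ℤ)
  /-- The infinite-depth operation `1 / f(D)` on qubit `i`, where `f(0) = 1`: for `t` running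
  upwards through the frames, a CNOT from qubit `i` of frame `t - l` to qubit `i` of frame `t` for
  every `l ≥ 1` such that `D ^ l` occurs in `f`. Each step touches only the present frame and the
  `deg f` frames before it, so that the operation is performed online. -/
  | infiniteDepth (i : Q) (f : (ZMod 2)[X]) (h : f.coeff 0 = 1)

namespace Gate

variable {Q : Type}

/-- The qubits of a frame on which an operation acts. -/
def qubits : Gate Q → Set Q
  | cnot i j _ _ => {i, j}
  | hadamard i => {i}
  | phase i => {i}
  | cphase i j _ _ => {i, j}
  | cphaseSelf i _ _ => {i}
  | delay i _ => {i}
  | infiniteDepth i _ _ => {i}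

/-- The finite-depth operations are all but the operations `1 / f(D)`. -/
def FiniteDepth : Gate Q → Prop
  | infiniteDepth _ _ _ => False
  | _ => True

/-- The action of an operation on Pauli sequences by conjugation, up to phases. -/
def act [DecidableEq Q] (g : Gate Q) (u : PauliRow Q) : PauliRow Q :=
  match g with
  | cnot i j k _ =>
      u + Pi.single (Sum.inr j) (delayPow k * u (Sum.inr i))
        + Pi.single (Sum.inl i) (delayPow (-k) * u (Sum.inl j))
  | hadamard i =>
      Function.update (Function.update u (Sum.inl i) (u (Sum.inr i))) (Sum.inr i) (u (Sum.inl i))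
  | phase i => u + Pi.single (Sum.inl i) (u (Sum.inr i))
  | cphase i j k _ =>
      u + Pi.single (Sum.inl j) (delayPow k * u (Sum.inr i))
        + Pi.single (Sum.inl i) (delayPow (-k) * u (Sum.inr j))
  | cphaseSelf i k _ =>
      u + Pi.single (Sum.inl i) ((delayPow k + delayPow (-k)) * u (Sum.inr i))
  | delay i l =>
      Function.update (Function.update u (Sum.inl i) (delayPow l * u (Sum.inl i)))
        (Sum.inr i) (delayPow l * u (Sum.inr i))
  | infiniteDepth i f _ =>
      Function.update
        (Function.update u (Sum.inl i)
          (toRat (LaurentPolynomial.invert (Polynomial.toLaurent f)) * u (Sum.inl i)))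
        (Sum.inr i) (u (Sum.inr i) / toRat (Polynomial.toLaurent f))

end Gate

/-- A circuit is a finite sequence of shift-invariant operations; the head acts first. -/
abbrev Circuit (Q : Type) : Type := List (Gate Q)

/-- The action of a circuit on Pauli sequences. -/
def Circuit.act {Q : Type} [DecidableEq Q] (C : Circuit Q) (u : PauliRow Q) : PauliRow Q :=
  C.foldl (fun v g => g.act v) u

/-- A circuit that consists of finite-depth operations only. -/
def Circuit.FiniteDepth {Q : Type} (C : Circuit Q) : Prop := ∀ g ∈ C, g.FiniteDepth

/-! ### Entanglement-assisted quantum convolutional codes -/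

/-- The qubits of one frame: the receiver's halves of the `c` ebits (`Sum.inl`) and the sender's
`n` qubits (`Sum.inr`). -/
abbrev FrameQubits (n c : ℕ) : Type := Fin c ⊕ Fin n

/-- How the sender's `n` qubits per frame are made up before encoding: `c` halves of ebits,
`n - k - c` ancilla qubits and `k` information qubits. -/
abbrev Layout (n k c : ℕ) : Type := Fin c ⊕ (Fin (n - k - c) ⊕ Fin k) ≃ Fin n

/-- Labels of the stabilizer generators: two for each ebit and one for each ancilla qubit. -/
abbrev StabIndex (n k c : ℕ) : Type := (Fin c ⊕ Fin c) ⊕ Fin (n - k - c)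

/-- Generators of the stabilizer of the unencoded stream: `Z ⊗ Z` and `X ⊗ X` on every ebit, and
`Z` on every ancilla qubit. -/
def initialStabilizer {n k c : ℕ} (e : Layout n k c) :
    StabIndex n k c → PauliRow (FrameQubits n c)
  | Sum.inl (Sum.inl i) => pauliZ (Sum.inl i) + pauliZ (Sum.inr (e (Sum.inl i)))
  | Sum.inl (Sum.inr i) => pauliX (Sum.inl i) + pauliX (Sum.inr (e (Sum.inl i)))
  | Sum.inr i => pauliZ (Sum.inr (e (Sum.inr (Sum.inl i))))

/-- The sender's qubit that holds the `i`-th information qubit of a frame before encoding. -/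
def infoQubit {n k c : ℕ} (e : Layout n k c) (i : Fin k) : FrameQubits n c :=
  Sum.inr (e (Sum.inr (Sum.inr i)))

/-- `u` and `v` differ by a (finite) product of delayed members of the family `S`. -/
def EqModStabilizer {Q σ : Type} [Fintype σ] (S : σ → PauliRow Q) (u v : PauliRow Q) : Prop :=
  ∃ m : σ → BLaurent, u = v + ∑ s, toRat (m s) • S s

/-- An `[[n, k; c]]` entanglement-assisted quantum convolutional code: per frame, the sender encodes
`k` information qubits with the help of `c` ebits and `n - k - c` ancilla qubits by an online
shift-invariant Clifford circuit that acts on her own qubits only; a finite-depth circuit of the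
receiver, who then holds all the qubits, restores the information qubits. -/
structure Code (n k c : ℕ) where
  /-- The composition of the sender's frame. -/
  layout : Layout n k c
  /-- The sender's encoding circuit. -/
  encoder : Circuit (FrameQubits n c)
  /-- The encoding circuit does not act on the receiver's halves of the ebits. -/
  encoder_local : ∀ g ∈ encoder, g.qubits ⊆ Set.range Sum.inr
  /-- The receiver's decoding circuit. -/
  decoder : Circuit (FrameQubits n c)
  /-- The decoding circuit has finite-depth operations only. -/
  decoder_finiteDepth : decoder.FiniteDepth
  /-- The qubits that hold the information qubits after decoding. -/
  output : Fin k ↪ FrameQubits n c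
  /-- Encoding and decoding takes the operator `Z` of each information qubit to the operator `Z` of
  its output qubit, up to the stabilizer of the decoded stream. -/
  decodes_Z : ∀ i, EqModStabilizer
    (fun s => decoder.act (encoder.act (initialStabilizer layout s)))
    (decoder.act (encoder.act (pauliZ (infoQubit layout i)))) (pauliZ (output i))
  /-- The same for the operators `X`. -/
  decodes_X : ∀ i, EqModStabilizer
    (fun s => decoder.act (encoder.act (initialStabilizer layout s)))
    (decoder.act (encoder.act (pauliX (infoQubit layout i)))) (pauliX (output i))

/-- Generators of the stabilizer of the encoded stream. -/
def Code.stabilizer {n k c : ℕ} (C : Code n k c) :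
    StabIndex n k c → PauliRow (FrameQubits n c) :=
  fun s => C.encoder.act (initialStabilizer C.layout s)

/-- The sender's part `[z(D) | x(D)]` of a Pauli sequence. -/
def senderPart {n c : ℕ} (u : FrameQubits n c ⊕ FrameQubits n c → BLaurent) :
    Fin n ⊕ Fin n → BLaurent :=
  Sum.elim (fun q => u (Sum.inl (Sum.inr q))) (fun q => u (Sum.inr (Sum.inr q)))

/-- The code `C` realizes the quantum check matrix `H(D)` on the sender's qubits: there are
finite-weight Pauli sequences `G`, the rows of `H(D)` extended to the receiver's halves of the
ebits, that commute with each other and with all their shifts and that arise from the stabilizer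
generators of the encoded stream by row operations, i.e. by a matrix `R(D)` that is invertible over
the rational functions. -/
def Code.Realizes {n k c : ℕ} (C : Code n k c) {ι : Type} [Fintype ι] [DecidableEq ι]
    (H : Matrix ι (Fin n ⊕ Fin n) BLaurent) : Prop :=
  ∃ (G : ι → FrameQubits n c ⊕ FrameQubits n c → BLaurent)
    (R : Matrix ι (StabIndex n k c) BLaurent) (R' : Matrix (StabIndex n k c) ι BRat),
    (∀ i, senderPart (G i) = H i) ∧
    (∀ i j, shiftedSymp (G i) (G j) = 0) ∧
    R.map toRat * R' = 1 ∧ R' * R.map toRat = 1 ∧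
    ∀ i, (fun q => toRat (G i q)) = ∑ s, toRat (R i s) • C.stabilizer s

/-- The quantum check matrix `[H₁(D) 0 | 0 H₂(D)]` in CSS form: the first rows are `Z`-type with
`H₁(D)`, the other rows are `X`-type with `H₂(D)`. -/
def cssCheckMatrix {r₁ r₂ n : ℕ} (H₁ : Matrix (Fin r₁) (Fin n) (ZMod 2)[X])
    (H₂ : Matrix (Fin r₂) (Fin n) (ZMod 2)[X]) :
    Matrix (Fin r₁ ⊕ Fin r₂) (Fin n ⊕ Fin n) BLaurent :=
  Matrix.fromBlocks (toLaurentMatrix H₁) 0 0 (toLaurentMatrix H₂)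

end EAQC

end

/-! Write `M†` for `Mᵀ(D⁻¹)`. Invertible row operations on `H₁` and on `H₂` absorb the outer factors
of a Smith-type factorization of `H₁ H₂†`, so it may be assumed that `H₁ H₂† = diag(γ, 0)` with
nonzero `γ₁, …, γ_c`; as the outer factors are invertible, `c` is the rank. The first `c` rows of
`H₁` and of `H₂` then clash in pairs, and each pair costs an ebit. The remaining `a₁` and `a₂` rows
commute with all the others and are carried by ancilla qubits.

Noncatastrophicity makes the Smith diagonal of each `Hᵢ` consist of powers of `D`, so `Hᵢ` has a
right inverse over the Laurent polynomials (`Noncatastrophic.exists_right_inverse`). Hence the rows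
of `H₂`, together with rows dual to the `a₁` commuting rows of `H₁`, extend to an invertible square
matrix `T` (`exists_completion`, `exists_frame_matrix`). Counting its rows gives `n = c + a₁ + a₂ +
k`, which is both the inequality and the number of information qubits.

Invertible Laurent matrices are products of transvections and diagonals of powers of `D`, that is,
of CNOTs and delays. So a finite-depth circuit multiplies `X` parts by `T` and `Z` parts by `(T⁻¹)†`
(`exists_circuit_of_mul_eq_one`). In these coordinates a commuting row of `H₁` is `Z` on one
ancilla, and row `a` of the first `c` is `γ_a` times `Z` on ebit qubit `a` plus some `Z` on
information qubits, with coefficients `P†`. Hadamards, CNOTs given by `P` and a scaling by `γ`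
prepare exactly these rows (`exists_precoder`). Only the scaling can need infinite depth, and if `γ`
is monomial it is a delay.

The receiver never has to undo the scaling. An encoded information `X` contains the infinite-weight
images of the ebit `X` operators with coefficients `P`; modulo the stabilizers `XX` these move to
the receiver's halves, where they have finite weight. Inverting `T` and cancelling `P` by CNOTs
decodes at finite depth (`exists_decoder`). `exists_code_of_frame` assembles the code. -/

namespace EAQC

/-! ### Elementary row and column operations -/

section Elementary

variable {E : Type*} [CommRing E]

/-- `N` arises from `M` by adding multiples of rows to other rows and of columns to other columns. -/
inductive ElemEquiv {ι κ : Type*} [DecidableEq ι] [DecidableEq κ] (M : Matrix ι κ E) :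
    Matrix ι κ E → Prop
  | refl : ElemEquiv M M
  | row {N : Matrix ι κ E} (i j : ι) (hij : i ≠ j) (a : E) (h : ElemEquiv M N) :
      ElemEquiv M (fun i' k => if i' = i then N i k + a * N j k else N i' k)
  | col {N : Matrix ι κ E} (i j : κ) (hij : i ≠ j) (a : E) (h : ElemEquiv M N) :
      ElemEquiv M (fun k i' => if i' = i then N k i + N k j * a else N k i')

/-- Products of transvections. -/
def elementary (ι : Type*) [DecidableEq ι] [Fintype ι] (E : Type*) [CommRing E] :
    Submonoid (Matrix ι ι E) :=
  Submonoid.closure {M | ∃ i j, i ≠ j ∧ ∃ a, M = Matrix.transvection i j a}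

variable {ι κ : Type*} [DecidableEq ι] [DecidableEq κ]

theorem ElemEquiv.of_eq {M N P : Matrix ι κ E} (h : ElemEquiv M N) (h' : P = N) :
    ElemEquiv M P := h' ▸ h

theorem ElemEquiv.trans {M N P : Matrix ι κ E} (h : ElemEquiv M N) (h' : ElemEquiv N P) :
    ElemEquiv M P := by
  induction h' with
  | refl => exact h
  | row i j hij a _ ih => exact .row i j hij a ih
  | col i j hij a _ ih => exact .col i j hij a ih

theorem ElemEquiv.transpose {M N : Matrix ι κ E} (h : ElemEquiv M N) :
    ElemEquiv M.transpose N.transpose := by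
  induction h with
  | refl => exact .refl
  | row i j hij a _ ih =>
    refine (ElemEquiv.col i j hij a ih).of_eq ?_
    ext k l; simp [Matrix.transpose, mul_comm a]
  | col i j hij a _ ih =>
    refine (ElemEquiv.row i j hij a ih).of_eq ?_
    ext k l; simp [Matrix.transpose, mul_comm a]

theorem ElemEquiv.exists_mul [Fintype ι] [Fintype κ] {M N : Matrix ι κ E} (h : ElemEquiv M N) :
    ∃ A ∈ elementary ι E, ∃ B ∈ elementary κ E, N = A * M * B := by
  induction h with
  | refl => exact ⟨1, one_mem _, 1, one_mem _, by simp⟩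
  | @row N i j hij a _ ih =>
    obtain ⟨A, hA, B, hB, rfl⟩ := ih
    refine ⟨Matrix.transvection i j a * A,
      mul_mem (Submonoid.subset_closure ⟨i, j, hij, a, rfl⟩) hA, B, hB, ?_⟩
    rw [show Matrix.transvection i j a * A * M * B = Matrix.transvection i j a * (A * M * B) by
      simp only [Matrix.mul_assoc]]
    ext i' k
    by_cases hi : i' = i
    · subst hi; simp
    · simp [hi]
  | @col N i j hij a _ ih =>
    obtain ⟨A, hA, B, hB, rfl⟩ := ih
    refine ⟨A, hA, B * Matrix.transvection j i a,
      mul_mem hB (Submonoid.subset_closure ⟨j, i, hij.symm, a, rfl⟩), ?_⟩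
    rw [← Matrix.mul_assoc]
    ext i' k
    by_cases hi : k = i
    · subst hi; simp [mul_comm a]
    · simp [hi]

/-- Row `i` is not in `s` and so stays unchanged, which allows its multiples to be subtracted from
one row after another. -/
theorem ElemEquiv.sub_row {M N : Matrix ι κ E} (h : ElemEquiv M N) (i : ι) (q : ι → E)
    (s : Finset ι) (hs : i ∉ s) :
    ElemEquiv M (fun i' k => if i' ∈ s then N i' k - q i' * N i k else N i' k) := by
  induction s using Finset.induction_on with
  | empty => simpa using h
  | insert a s ha ih =>
    have hi : i ∉ s := fun h' => hs (Finset.mem_insert_of_mem h')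
    have hia : i ≠ a := fun h' => hs (h' ▸ Finset.mem_insert_self _ _)
    refine (ElemEquiv.row a i hia.symm (-q a) (ih hi)).of_eq ?_
    ext i' k
    by_cases h1 : i' = a
    · subst h1; simp [ha, hi]; ring
    · simp [h1]

/-- The matrix with the entry `d` in the corner, the block `N` and zeros elsewhere. -/
def bordered {m n : ℕ} (d : E) (N : Matrix (Fin m) (Fin n) E) :
    Matrix (Fin (m + 1)) (Fin (n + 1)) E :=
  fun i j => Fin.cases (Fin.cases d (fun _ => 0) j) (fun i' => Fin.cases 0 (fun j' => N i' j') j) i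

theorem ElemEquiv.bordered {m n : ℕ} (d : E) {M N : Matrix (Fin m) (Fin n) E}
    (h : ElemEquiv M N) : ElemEquiv (bordered d M) (bordered d N) := by
  induction h with
  | refl => exact .refl
  | row i j hij a _ ih =>
    refine (ElemEquiv.row i.succ j.succ (by simpa using hij) a ih).of_eq ?_
    ext k l
    cases k using Fin.cases <;> cases l using Fin.cases <;>
      simp [EAQC.bordered, (Fin.succ_ne_zero _).symm]
  | col i j hij a _ ih =>
    refine (ElemEquiv.col i.succ j.succ (by simpa using hij) a ih).of_eq ?_
    ext k l
    cases k using Fin.cases <;> cases l using Fin.cases <;>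
      simp [EAQC.bordered, (Fin.succ_ne_zero _).symm]

/-- The `m × n` matrix whose first `s` diagonal entries are `d 0, …, d (s - 1)` and whose other
entries are zero. -/
def partialDiagonal (m n s : ℕ) (d : ℕ → E) : Matrix (Fin m) (Fin n) E :=
  fun i j => if i.val = j.val ∧ i.val < s then d i.val else 0

theorem bordered_partialDiagonal {m n s : ℕ} (x : E) (d : ℕ → E) :
    bordered x (partialDiagonal m n s d) =
      partialDiagonal (m + 1) (n + 1) (s + 1) (fun i => Nat.casesOn i x d) := by
  ext i j
  cases i using Fin.cases <;> cases j using Fin.cases <;> simp [bordered, partialDiagonal]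

end Elementary

/-! ### Diagonalization over a Euclidean domain -/

section Euclidean

variable {E : Type*} [EuclideanDomain E] [DecidableEq E]

/-- The pivot `x` is minimal for the Euclidean order among all nonzero entries of all matrices
equivalent to `M`. A nonzero remainder in its row or column would be smaller, so `x` divides both,
and they can be cleared. -/
theorem exists_elemEquiv_bordered {m n : ℕ} (M : Matrix (Fin (m + 1)) (Fin (n + 1)) E)
    (hM : M ≠ 0) : ∃ x ≠ 0, ∃ N, ElemEquiv M (bordered x N) := by
  classical
  let S : Set E := {x | x ≠ 0 ∧ ∃ N, ElemEquiv M N ∧ ∃ i j, N i j = x}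
  have hS : S.Nonempty := by
    by_contra h
    apply hM
    ext i j
    by_contra hij
    exact h ⟨M i j, hij, M, .refl, i, j, rfl⟩
  obtain ⟨x, ⟨hx, N, hN, i, j, hij⟩, hmin⟩ :=
    (EuclideanDomain.r_wellFounded (R := E)).has_min S hS
  have hcol : ∀ N, ElemEquiv M N → ∀ i j, N i j = x → ∀ i', x ∣ N i' j := by
    intro N hN i j hij i'
    by_cases hii : i' = i
    · rw [hii, hij]
    rw [← EuclideanDomain.mod_eq_zero]
    by_contra h
    refine hmin _ ⟨h, _, .row i' i hii (-(N i' j / x)) hN, i', j, ?_⟩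
      (EuclideanDomain.mod_lt _ hx)
    simp only [if_true, hij]
    rw [EuclideanDomain.mod_eq_sub_mul_div]; ring
  have hrow : ∀ N, ElemEquiv M N → ∀ i j, N i j = x → ∀ j', x ∣ N i j' := by
    intro N hN i j hij j'
    by_cases hii : j' = j
    · rw [hii, hij]
    rw [← EuclideanDomain.mod_eq_zero]
    by_contra h
    refine hmin _ ⟨h, _, .col j' j hii (-(N i j' / x)) hN, i, j', ?_⟩
      (EuclideanDomain.mod_lt _ hx)
    simp only [if_true, hij]
    rw [EuclideanDomain.mod_eq_sub_mul_div]; ring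
  obtain ⟨N, hN, hij⟩ : ∃ N, ElemEquiv M N ∧ N 0 j = x := by
    by_cases hi : i = 0
    · exact ⟨N, hN, hi ▸ hij⟩
    obtain ⟨q, hq⟩ := hcol N hN i j hij 0
    -- A row swap is not available. As entry `(0, j)` is `x * q`, adding `1 - q` times row `i` turns
    -- it into `x`.
    refine ⟨_, .row 0 i (Ne.symm hi) (1 - q) hN, ?_⟩
    simp only [if_true, hij, hq]; ring
  obtain ⟨N, hN, hij⟩ : ∃ N, ElemEquiv M N ∧ N 0 0 = x := by
    by_cases hi : j = 0
    · exact ⟨N, hN, hi ▸ hij⟩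
    obtain ⟨q, hq⟩ := hrow N hN 0 j hij 0
    refine ⟨_, .col 0 j (Ne.symm hi) (1 - q) hN, ?_⟩
    simp only [if_true, hij, hq]; ring
  choose q hq using hcol N hN 0 0 hij
  have h1 := hN.sub_row 0 q (Finset.univ.erase 0) (by simp)
  set N₁ : Matrix (Fin (m + 1)) (Fin (n + 1)) E := _ with hN₁
  change ElemEquiv M N₁ at h1
  have h00 : N₁ 0 0 = x := by simp [hN₁, hij]
  have hi0 : ∀ i, i ≠ 0 → N₁ i 0 = 0 := by
    intro i hi; simp [hN₁, hi, hij, hq]; ring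
  -- The first column is now zero below the corner, so clearing the first row by column operations
  -- changes no other row.
  choose q' hq' using hrow N₁ h1 0 0 h00
  have h2 := h1.transpose.sub_row 0 q' (Finset.univ.erase 0) (by simp)
  have h3 := h2.transpose
  refine ⟨x, hx, fun i j => N₁ i.succ j.succ - q' j.succ * N₁ i.succ 0, h3.of_eq ?_⟩
  ext i j
  cases i using Fin.cases with
  | zero =>
    cases j using Fin.cases with
    | zero => simp [bordered, Matrix.transpose, h00]
    | succ j => simp [bordered, Matrix.transpose, h00, hq']; ring
  | succ i =>
    cases j using Fin.cases with
    | zero => simp [bordered, Matrix.transpose, hi0]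
    | succ j => simp [bordered, Matrix.transpose]

theorem exists_elemEquiv_partialDiagonal : ∀ {m n : ℕ} (M : Matrix (Fin m) (Fin n) E),
    ∃ s d, s ≤ m ∧ s ≤ n ∧ (∀ i < s, d i ≠ 0) ∧ ElemEquiv M (partialDiagonal m n s d)
  | 0, n, M => ⟨0, fun _ => 0, by simp, by simp, by simp, 
      ElemEquiv.refl.of_eq (by ext i; exact i.elim0)⟩
  | m + 1, 0, M => ⟨0, fun _ => 0, by simp, by simp, by simp, 
      ElemEquiv.refl.of_eq (by ext i j; exact j.elim0)⟩
  | m + 1, n + 1, M => by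
    by_cases hM : M = 0
    · refine ⟨0, fun _ => 0, by simp, by simp, by simp, ElemEquiv.refl.of_eq ?_⟩
      ext i j; simp [hM, partialDiagonal]
    · obtain ⟨x, hx, N, hN⟩ := exists_elemEquiv_bordered M hM
      obtain ⟨s, d, hm, hn, hd, h⟩ := exists_elemEquiv_partialDiagonal N
      refine ⟨s + 1, fun i => Nat.casesOn i x d, by omega, by omega, ?_, ?_⟩
      · rintro (_ | i) hi
        · exact hx
        · exact hd i (by omega)
      · rw [← bordered_partialDiagonal]
        exact hN.trans (h.bordered x)

end Euclidean

/-! ### Inverses and images of products of transvections -/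

section Elementary

variable {E : Type*} [CommRing E] {ι : Type*} [DecidableEq ι] [Fintype ι]

theorem exists_inverse_of_mem_elementary {A : Matrix ι ι E} (hA : A ∈ elementary ι E) :
    ∃ A' ∈ elementary ι E, A * A' = 1 ∧ A' * A = 1 := by
  induction hA using Submonoid.closure_induction with
  | mem A hA =>
    obtain ⟨i, j, hij, a, rfl⟩ := hA
    exact ⟨_, Submonoid.subset_closure ⟨i, j, hij, -a, rfl⟩,
      by simp [Matrix.transvection_mul_transvection_same, hij],
      by simp [Matrix.transvection_mul_transvection_same, hij]⟩
  | one => exact ⟨1, one_mem _, by simp, by simp⟩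
  | mul A B _ _ hA hB =>
    obtain ⟨A', hA', h1, h2⟩ := hA
    obtain ⟨B', hB', h3, h4⟩ := hB
    refine ⟨B' * A', mul_mem hB' hA', ?_, ?_⟩
    · rw [Matrix.mul_assoc, ← Matrix.mul_assoc B, h3, Matrix.one_mul, h1]
    · rw [Matrix.mul_assoc, ← Matrix.mul_assoc A', h2, Matrix.one_mul, h4]

theorem isUnit_of_mem_elementary {A : Matrix ι ι E} (hA : A ∈ elementary ι E) : IsUnit A := by
  obtain ⟨A', -, h1, h2⟩ := exists_inverse_of_mem_elementary hA
  exact ⟨⟨A, A', h1, h2⟩, rfl⟩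

theorem map_mem_elementary {F : Type*} [CommRing F] (f : E →+* F) {A : Matrix ι ι E}
    (hA : A ∈ elementary ι E) : A.map f ∈ elementary ι F := by
  induction hA using Submonoid.closure_induction with
  | mem A hA =>
    obtain ⟨i, j, hij, a, rfl⟩ := hA
    refine Submonoid.subset_closure ⟨i, j, hij, f a, ?_⟩
    ext k l
    simp [Matrix.transvection, Matrix.one_apply, Matrix.single_apply, apply_ite f]
  | one => simp
  | mul A B _ _ hA hB => rw [Matrix.map_mul]; exact mul_mem hA hB

theorem partialDiagonal_map {F : Type*} [CommRing F] (f : E →+* F) (m n s : ℕ) (d : ℕ → E) :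
    (partialDiagonal m n s d).map f = partialDiagonal m n s (fun i => f (d i)) := by
  ext i j
  simp [partialDiagonal, apply_ite f]

theorem partialDiagonal_eq_diagonal (n s : ℕ) (d : ℕ → E) :
    partialDiagonal n n s d = Matrix.diagonal fun i : Fin n => if i.val < s then d i.val else 0 := by
  ext i j
  simp only [partialDiagonal, Matrix.diagonal_apply, Fin.ext_iff]
  by_cases h : i.val = j.val <;> simp [h]

end Elementary

/-- Smith form, without the divisibility of the invariant factors. -/
theorem exists_eq_mul_partialDiagonal_mul {E : Type*} [EuclideanDomain E] [DecidableEq E]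
    {m n : ℕ} (M : Matrix (Fin m) (Fin n) E) :
    ∃ A ∈ elementary (Fin m) E, ∃ B ∈ elementary (Fin n) E, ∃ (s : ℕ) (d : ℕ → E), s ≤ m ∧ s ≤ n ∧
      (∀ i < s, d i ≠ 0) ∧ M = A * partialDiagonal m n s d * B := by
  obtain ⟨s, d, hm, hn, hd, h⟩ := exists_elemEquiv_partialDiagonal M
  obtain ⟨A, hA, B, hB, h⟩ := h.exists_mul
  obtain ⟨A', hA', -, h1⟩ := exists_inverse_of_mem_elementary hA
  obtain ⟨B', hB', h2, -⟩ := exists_inverse_of_mem_elementary hB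
  refine ⟨A', hA', B', hB', s, d, hm, hn, hd, ?_⟩
  rw [h, Matrix.mul_assoc, Matrix.mul_assoc (A * M), h2, Matrix.mul_one, ← Matrix.mul_assoc, h1,
    Matrix.one_mul]

/-! ### Laurent polynomials -/

theorem eq_one_of_isUnit {p : (ZMod 2)[X]} (hp : IsUnit p) : p = 1 := by
  obtain ⟨a, ha, rfl⟩ := Polynomial.isUnit_iff.mp hp
  have : a = 1 := by
    have h0 := ha.ne_zero
    clear ha hp; revert a; decide
  simp [this]

/-- A unit divides some power of the prime `X` already among the polynomials, and the only unit of
`𝔽₂[X]` is `1`. -/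
theorem exists_eq_X_pow_of_isUnit_toLaurent {p : (ZMod 2)[X]}
    (hp : IsUnit (Polynomial.toLaurent p)) : ∃ k : ℕ, p = Polynomial.X ^ k := by
  obtain ⟨g, hg⟩ := hp.exists_right_inv
  obtain ⟨m, g', hg'⟩ := LaurentPolynomial.exists_T_pow g
  have h : p * g' = Polynomial.X ^ m := by
    apply Polynomial.toLaurent_injective
    rw [map_mul, hg', ← mul_assoc, hg, Polynomial.toLaurent_X_pow, one_mul]
  obtain ⟨k, -, hk⟩ := (dvd_prime_pow Polynomial.prime_X m).mp ⟨g', h.symm⟩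
  obtain ⟨u, hu⟩ := hk
  rw [eq_one_of_isUnit u.isUnit, mul_one] at hu
  exact ⟨k, hu⟩

theorem exists_eq_X_pow_mul {p : (ZMod 2)[X]} (hp : p ≠ 0) :
    ∃ (k : ℕ) (g : (ZMod 2)[X]), p = Polynomial.X ^ k * g ∧ g.coeff 0 = 1 := by
  obtain ⟨g, hg, h⟩ := Polynomial.exists_eq_pow_rootMultiplicity_mul_and_not_dvd p hp 0
  refine ⟨p.rootMultiplicity 0, g, by simpa using hg, ?_⟩
  rw [map_zero, sub_zero, Polynomial.X_dvd_iff] at h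
  revert h; generalize g.coeff 0 = a; revert a; decide

theorem exists_eq_T_mul_toLaurent {f : BLaurent} (hf : f ≠ 0) :
    ∃ (l : ℤ) (g : (ZMod 2)[X]), f = LaurentPolynomial.T l * Polynomial.toLaurent g ∧
      g.coeff 0 = 1 := by
  obtain ⟨m, p, hp⟩ := LaurentPolynomial.exists_T_pow f
  have hp' : p ≠ 0 := by
    rintro rfl
    rw [map_zero] at hp
    exact hf ((mul_eq_zero.mp hp.symm).resolve_right (LaurentPolynomial.isUnit_T _).ne_zero)
  obtain ⟨k, g, rfl, hg⟩ := exists_eq_X_pow_mul hp'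
  refine ⟨k - m, g, ?_, hg⟩
  rw [map_mul, Polynomial.toLaurent_X_pow] at hp
  rw [LaurentPolynomial.T_sub, mul_right_comm, hp, mul_assoc, ← LaurentPolynomial.T_add]
  simp

/-- An ideal of the localization of `𝔽₂[X]` at the powers of `X` is generated by its contraction,
which is principal. This provides the free complements in `exists_completion`. -/
instance : IsPrincipalIdealRing BLaurent where
  principal I := by
    have h := IsLocalization.map_under (Submonoid.powers (Polynomial.X : (ZMod 2)[X])) BLaurent I
    obtain ⟨p, hp⟩ := IsPrincipalIdealRing.principal
      (I.under (ZMod 2)[X])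
    refine ⟨algebraMap (ZMod 2)[X] BLaurent p, ?_⟩
    rw [← h, hp]
    change Ideal.map _ (Ideal.span {p}) = Ideal.span _
    rw [Ideal.map_span, Set.image_singleton]

theorem exists_T_mul_eq_map_toLaurent {ι κ : Type*} [Finite ι] [Finite κ]
    (M : Matrix ι κ BLaurent) : ∃ (N : ℕ) (M' : Matrix ι κ (ZMod 2)[X]),
      M'.map Polynomial.toLaurent = (LaurentPolynomial.T N : BLaurent) • M := by
  classical
  cases nonempty_fintype ι
  cases nonempty_fintype κ
  choose N M' h using fun i j => LaurentPolynomial.exists_T_pow (M i j)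
  -- The sum of all exponents serves as a common bound.
  let S := ∑ i, ∑ j, N i j
  have hS : ∀ i j, N i j ≤ S := fun i j =>
    (Finset.single_le_sum (f := fun j => N i j) (fun _ _ => Nat.zero_le _) (Finset.mem_univ j)).trans
      (Finset.single_le_sum (f := fun i => ∑ j, N i j) (fun _ _ => Nat.zero_le _)
        (Finset.mem_univ i))
  refine ⟨S, Matrix.of fun i j => M' i j * Polynomial.X ^ (S - N i j), ?_⟩
  ext1 i j
  simp only [Matrix.map_apply, Matrix.of_apply, map_mul, h, Polynomial.toLaurent_X_pow, Matrix.smul_apply,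
    smul_eq_mul]
  rw [mul_assoc, ← LaurentPolynomial.T_add, Nat.cast_sub (hS i j), mul_comm]
  congr 2
  ring

/-- A power of `D` clears the denominators, and after diagonalization over `𝔽₂[D]` it is divided out
of the diagonal. -/
theorem exists_smith {m n : ℕ} (M : Matrix (Fin m) (Fin n) BLaurent) :
    ∃ (A : Matrix (Fin m) (Fin m) BLaurent) (B : Matrix (Fin n) (Fin n) BLaurent) (s : ℕ)
      (d : ℕ → BLaurent), IsUnit A ∧ IsUnit B ∧ s ≤ m ∧ s ≤ n ∧ (∀ i < s, d i ≠ 0) ∧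
      M = A * partialDiagonal m n s d * B := by
  classical
  obtain ⟨N, M', h⟩ := exists_T_mul_eq_map_toLaurent M
  obtain ⟨A, hA, B, hB, s, d, hm, hn, hd, rfl⟩ := exists_eq_mul_partialDiagonal_mul M'
  refine ⟨A.map Polynomial.toLaurent, B.map Polynomial.toLaurent, s,
    fun i => LaurentPolynomial.T (-N) * Polynomial.toLaurent (d i),
    isUnit_of_mem_elementary (map_mem_elementary _ hA),
    isUnit_of_mem_elementary (map_mem_elementary _ hB), hm, hn,
    fun i hi => mul_ne_zero (LaurentPolynomial.isUnit_T _).ne_zero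
      (Polynomial.toLaurent_ne_zero.mpr (hd i hi)), ?_⟩
  have h1 : partialDiagonal m n s (fun i => LaurentPolynomial.T (-N) * Polynomial.toLaurent (d i)) =
      (LaurentPolynomial.T (-N) : BLaurent) • (partialDiagonal m n s d).map Polynomial.toLaurent := by
    rw [partialDiagonal_map]
    ext1 i j
    simp [partialDiagonal]
  rw [h1, Matrix.mul_smul, Matrix.smul_mul, ← Matrix.map_mul, ← Matrix.map_mul, h, smul_smul,
    ← LaurentPolynomial.T_add]
  simp

/-- Matrices generated by transvections and diagonal matrices of powers of `D`. -/
noncomputable def circuitMatrices (ι : Type*) [DecidableEq ι] [Fintype ι] : Submonoid (Matrix ι ι BLaurent) :=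
  Submonoid.closure ({M | ∃ i j, i ≠ j ∧ ∃ a, M = Matrix.transvection i j a} ∪
    {M | ∃ e : ι → ℤ, M = Matrix.diagonal fun i => LaurentPolynomial.T (e i)})

/-- In a diagonalization of an invertible matrix the diagonal entries are units, hence powers of
`D`; the outer factors are products of transvections. -/
theorem mem_circuitMatrices_of_isUnit {n : ℕ} {M : Matrix (Fin n) (Fin n) BLaurent}
    (hM : IsUnit M) : M ∈ circuitMatrices (Fin n) := by
  classical
  obtain ⟨N, M', h⟩ := exists_T_mul_eq_map_toLaurent M
  obtain ⟨A, hA, B, hB, s, d, -, -, -, rfl⟩ := exists_eq_mul_partialDiagonal_mul M'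
  have hsub : elementary (Fin n) BLaurent ≤ circuitMatrices (Fin n) :=
    Submonoid.closure_mono Set.subset_union_left
  have hdiag : ∀ e : Fin n → ℤ, Matrix.diagonal (fun i => LaurentPolynomial.T (e i)) ∈
      circuitMatrices (Fin n) := fun e => Submonoid.subset_closure (Or.inr ⟨e, rfl⟩)
  have hM' : M = Matrix.diagonal (fun _ => LaurentPolynomial.T (-N : ℤ)) *
      (A.map Polynomial.toLaurent * (partialDiagonal n n s d).map Polynomial.toLaurent *
        B.map Polynomial.toLaurent) := by
    rw [← Matrix.map_mul, ← Matrix.map_mul, h, ← Matrix.smul_eq_diagonal_mul, smul_smul,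
      ← LaurentPolynomial.T_add]
    simp
  have hu : IsUnit ((partialDiagonal n n s d).map (Polynomial.toLaurent (R := ZMod 2))) := by
    rw [Matrix.isUnit_iff_isUnit_det] at hM ⊢
    rw [hM', Matrix.det_mul, Matrix.det_mul, Matrix.det_mul] at hM
    exact isUnit_of_mul_isUnit_right (isUnit_of_mul_isUnit_left (isUnit_of_mul_isUnit_right hM))
  rw [partialDiagonal_eq_diagonal, Matrix.diagonal_map (map_zero _)] at hu
  rw [Matrix.isUnit_diagonal, Pi.isUnit_iff] at hu
  choose k hk using fun i => exists_eq_X_pow_of_isUnit_toLaurent (hu i)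
  rw [hM', partialDiagonal_eq_diagonal, Matrix.diagonal_map (map_zero _)]
  refine mul_mem (hdiag _) (mul_mem (mul_mem (hsub (map_mem_elementary _ hA)) ?_)
    (hsub (map_mem_elementary _ hB)))
  convert hdiag (fun i => (k i : ℤ)) using 3 with i
  change Polynomial.toLaurent (if i.val < s then d i.val else 0) = _
  rw [hk i, Polynomial.toLaurent_X_pow]

/-! ### Partial diagonal matrices and their rank -/

section PartialDiagonal

variable {E : Type*} [CommRing E]

theorem partialDiagonal_mul_partialDiagonal {m n p s : ℕ} (hs : s ≤ n) (d d' : ℕ → E) :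
    partialDiagonal m n s d * partialDiagonal n p s d' =
      partialDiagonal m p s (fun i => d i * d' i) := by
  ext i j
  rw [Matrix.mul_apply]
  by_cases hi : i.val < s
  · rw [Finset.sum_eq_single (⟨i.val, hi.trans_le hs⟩ : Fin n)]
    · by_cases hj : i.val = j.val
      · have hj' : j.val < s := hj ▸ hi
        simp [partialDiagonal, hj, hj']
      · simp [partialDiagonal, hj]
    · intro l _ hl
      have : i.val ≠ l.val := fun h => hl (Fin.ext h.symm)
      simp [partialDiagonal, this]
    · simp
  · simp [partialDiagonal, hi]

theorem partialDiagonal_one (n : ℕ) : partialDiagonal n n n (fun _ => (1 : E)) = 1 := by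
  rw [partialDiagonal_eq_diagonal]
  simp

end PartialDiagonal

/-- The matrix factors through dimension `s`; conversely, multiplying it on both sides by suitable
matrices gives the `s × s` identity. -/
theorem rank_partialDiagonal {K : Type*} [Field K] {m n s : ℕ} (hm : s ≤ m) (hn : s ≤ n)
    {d : ℕ → K} (hd : ∀ i < s, d i ≠ 0) : (partialDiagonal m n s d).rank = s := by
  apply le_antisymm
  · have h : partialDiagonal m n s d =
        partialDiagonal m s s d * partialDiagonal s n s (fun _ => (1 : K)) := by
      rw [partialDiagonal_mul_partialDiagonal le_rfl]; simp
    rw [h]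
    exact (Matrix.rank_mul_le_left _ _).trans ((Matrix.rank_le_card_width _).trans (by simp))
  · have h : partialDiagonal s m s (fun i => (d i)⁻¹) *
        (partialDiagonal m n s d * partialDiagonal n s s (fun _ => (1 : K))) = 1 := by
      rw [partialDiagonal_mul_partialDiagonal hn, partialDiagonal_mul_partialDiagonal hm,
        ← partialDiagonal_one]
      ext i j
      by_cases hij : i.val = j.val <;> simp [partialDiagonal, hij, hd]
    have h1 : (1 : Matrix (Fin s) (Fin s) K).rank = s := by simp [Matrix.rank_one]
    rw [← h] at h1
    calc s = _ := h1.symm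
      _ ≤ _ := Matrix.rank_mul_le_right _ _
      _ ≤ _ := Matrix.rank_mul_le_left _ _

theorem toRat_injective : Function.Injective toRat := IsFractionRing.injective BLaurent BRat

theorem ratRank_mul_partialDiagonal_mul {m n s : ℕ} {A : Matrix (Fin m) (Fin m) BLaurent}
    {B : Matrix (Fin n) (Fin n) BLaurent} (hA : IsUnit A) (hB : IsUnit B) (hm : s ≤ m) (hn : s ≤ n)
    {d : ℕ → BLaurent} (hd : ∀ i < s, d i ≠ 0) :
    ratRank (A * partialDiagonal m n s d * B) = s := by
  have hA' : IsUnit (A.map toRat).det := by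
    rw [← Matrix.isUnit_iff_isUnit_det]
    exact hA.map toRat.mapMatrix
  have hB' : IsUnit (B.map toRat).det := by
    rw [← Matrix.isUnit_iff_isUnit_det]
    exact hB.map toRat.mapMatrix
  rw [ratRank, Matrix.map_mul, Matrix.map_mul, Matrix.rank_mul_eq_left_of_isUnit_det _ _ hB',
    Matrix.rank_mul_eq_right_of_isUnit_det _ _ hA', partialDiagonal_map]
  refine rank_partialDiagonal hm hn fun i hi h => hd i hi (toRat_injective ?_)
  rw [h, map_zero]

/-! ### Noncatastrophic matrices -/

theorem not_exists_coe_eq_mk_one : ¬ ∃ p : (ZMod 2)[X],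
    (p : PowerSeries (ZMod 2)) = PowerSeries.mk fun _ => 1 := by
  rintro ⟨p, hp⟩
  have h := congrArg (PowerSeries.coeff (p.natDegree + 1)) hp
  rw [Polynomial.coeff_coe, PowerSeries.coeff_mk, Polynomial.coeff_eq_zero_of_natDegree_lt] at h
  · exact zero_ne_one h
  · omega

theorem Noncatastrophic.exists_right_inverse {r n : ℕ} {H : Matrix (Fin r) (Fin n) (ZMod 2)[X]}
    (hH : Noncatastrophic H) :
    ∃ K : Matrix (Fin n) (Fin r) BLaurent, toLaurentMatrix H * K = 1 := by
  classical
  obtain ⟨A, hA, B, hB, s, d, hsr, hsn, hd, rfl⟩ := exists_eq_mul_partialDiagonal_mul H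
  obtain ⟨A', hA', hAA', hA'A⟩ := exists_inverse_of_mem_elementary hA
  obtain ⟨B', hB', hBB', hB'B⟩ := exists_inverse_of_mem_elementary hB
  let φ : (ZMod 2)[X] →+* PowerSeries (ZMod 2) := Polynomial.coeToPowerSeries.ringHom
  have hφ : ∀ p : (ZMod 2)[X], (p : PowerSeries (ZMod 2)) = φ p := fun _ => rfl
  -- The input `w` times row `i` of `A⁻¹` has as output `w` times row `i` of the diagonal matrix
  -- times `B`. If that input is polynomial, multiplying it by column `i` of `A` recovers `w`.
  have key : ∀ (i : Fin r) (w : PowerSeries (ZMod 2)),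
      (∀ l, ∃ p : (ZMod 2)[X], φ p = w * φ ((partialDiagonal r n s d * B) i l)) →
      ∃ p : (ZMod 2)[X], φ p = w := by
    intro i w hw
    have h := hH (fun j => w * φ (A' i j)) fun l => by
      obtain ⟨p, hp⟩ := hw l
      refine ⟨p, ?_⟩
      rw [hφ, hp]
      simp only [hφ, mul_assoc w]
      rw [← Finset.mul_sum]
      simp only [← map_mul, ← map_sum]
      rw [← Matrix.mul_apply, Matrix.mul_assoc, ← Matrix.mul_assoc A', hA'A, Matrix.one_mul]
    choose p hp using h
    refine ⟨∑ j, p j * A j i, ?_⟩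
    rw [map_sum]
    simp only [map_mul]
    have : ∀ j, φ (p j) = w * φ (A' i j) := hp
    simp only [this, mul_assoc w]
    rw [← Finset.mul_sum]
    simp only [← map_mul, ← map_sum]
    rw [← Matrix.mul_apply, hA'A]
    simp
  have hrow : ∀ i : Fin r, ∀ h : i.val < s, ∀ l,
      (partialDiagonal r n s d * B) i l = d i * B ⟨i.val, h.trans_le hsn⟩ l := by
    intro i h l
    rw [Matrix.mul_apply, Finset.sum_eq_single (⟨i.val, h.trans_le hsn⟩ : Fin n)]
    · simp [partialDiagonal, h]
    · intro l _ hl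
      have : i.val ≠ l.val := fun h => hl (Fin.ext h.symm)
      simp [partialDiagonal, this]
    · simp
  -- A zero row would let the all-ones series pass as `w`.
  have hs : s = r := by
    by_contra hne
    have hlt : s < r := lt_of_le_of_ne hsr hne
    apply not_exists_coe_eq_mk_one
    refine key ⟨s, hlt⟩ _ fun l => ⟨0, ?_⟩
    have : (partialDiagonal r n s d * B) ⟨s, hlt⟩ l = 0 := by
      simp [Matrix.mul_apply, partialDiagonal]
    rw [this]; simp
  subst hs
  have hpow : ∀ i : Fin s, ∃ k : ℕ, d i = Polynomial.X ^ k := by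
    intro i
    obtain ⟨k, g, hk, hg⟩ := exists_eq_X_pow_mul (hd i i.isLt)
    have hg' : PowerSeries.constantCoeff (φ g) ≠ 0 := by
      rw [← hφ, ← PowerSeries.coeff_zero_eq_constantCoeff_apply, Polynomial.coeff_coe, hg]
      exact one_ne_zero
    -- The input `1 / g` cancels the factor `g` of `d i` and leaves a polynomial output, so `1 / g`
    -- is a polynomial.
    obtain ⟨p, hp⟩ := key i (φ g)⁻¹ fun l => ⟨Polynomial.X ^ k * B ⟨i.val, i.isLt.trans_le hsn⟩ l, by
      rw [hrow i i.isLt, hk, mul_comm (Polynomial.X ^ k) g, mul_assoc g, map_mul φ g, ← mul_assoc,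
        PowerSeries.inv_mul_cancel _ hg', one_mul]⟩
    have hpg : p * g = 1 := by
      apply Polynomial.coe_injective (ZMod 2)
      change φ (p * g) = φ 1
      rw [map_mul, hp, PowerSeries.inv_mul_cancel _ hg', map_one]
    have : g = 1 := eq_one_of_isUnit (IsUnit.of_mul_eq_one_right p hpg)
    exact ⟨k, by rw [hk, this, mul_one]⟩
  choose k hk using hpow
  let e : ℕ → ℤ := fun i => if h : i < s then k ⟨i, h⟩ else 0
  refine ⟨B'.map Polynomial.toLaurent *
    (partialDiagonal n s s (fun i => (LaurentPolynomial.T (-e i) : BLaurent)) *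
      A'.map Polynomial.toLaurent), ?_⟩
  have h1 : (partialDiagonal s n s d).map Polynomial.toLaurent *
      partialDiagonal n s s (fun i => (LaurentPolynomial.T (-e i) : BLaurent)) = 1 := by
    rw [partialDiagonal_map, partialDiagonal_mul_partialDiagonal hsn, ← partialDiagonal_one]
    ext1 i j
    by_cases hij : i.val = j.val
    · simp only [partialDiagonal, hij, j.isLt, and_self, if_true]
      rw [hk j, Polynomial.toLaurent_X_pow, ← LaurentPolynomial.T_add]
      simp [e]
    · simp [partialDiagonal, hij]
  rw [toLaurentMatrix, Matrix.map_mul, Matrix.map_mul, Matrix.mul_assoc,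
    ← Matrix.mul_assoc (B.map _), ← Matrix.map_mul (L := B) (M := B'), hBB']
  simp only [Matrix.map_one _ (map_zero _) (map_one _), Matrix.one_mul]
  rw [Matrix.mul_assoc, ← Matrix.mul_assoc ((partialDiagonal s n s d).map _), h1, Matrix.one_mul,
    ← Matrix.map_mul, hAA', Matrix.map_one _ (map_zero _) (map_one _)]

/-! ### Completion to an invertible matrix -/

/-- As `S V = 1`, the map `x ↦ x - x V S` projects onto the kernel of `x ↦ x V`, which is free over
a principal ideal domain. The rows of `Z` are a basis of this kernel, and `N` gives the coordinates
of the projection. -/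
theorem exists_completion {R : Type*} [CommRing R] [IsDomain R] [IsPrincipalIdealRing R]
    {σ ν : Type*} [Fintype σ] [Fintype ν] [DecidableEq σ] [DecidableEq ν]
    (S : Matrix σ ν R) (V : Matrix ν σ R) (h : S * V = 1) :
    ∃ (s : ℕ) (Z : Matrix (Fin s) ν R) (N : Matrix ν (Fin s) R),
      Fintype.card σ + s = Fintype.card ν ∧ S * N = 0 ∧ Z * V = 0 ∧ Z * N = 1 ∧
        V * S + N * Z = 1 := by
  let K : Submodule R (ν → R) := LinearMap.ker (Matrix.vecMulLinear V)
  obtain ⟨s, ⟨b⟩⟩ := Submodule.nonempty_basis_of_pid (Pi.basisFun R ν) K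
  have hmem : ∀ x : ν → R, x - Matrix.vecMul (Matrix.vecMul x V) S ∈ K := by
    intro x
    rw [LinearMap.mem_ker, Matrix.vecMulLinear_apply, Matrix.sub_vecMul, Matrix.vecMul_vecMul, h,
      Matrix.vecMul_one, sub_self]
  let f : (ν → R) →ₗ[R] K :=
    (LinearMap.id - (Matrix.vecMulLinear S).comp (Matrix.vecMulLinear V)).codRestrict K
      (fun x => by simpa using hmem x)
  let g : (ν → R) →ₗ[R] (Fin s → R) := b.equivFun.toLinearMap.comp f
  let N : Matrix ν (Fin s) R := Matrix.of fun q => g (Pi.single q 1)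
  have hN : ∀ x : ν → R, Matrix.vecMul x N = g x := by
    intro x
    conv_rhs => rw [← Finset.univ_sum_single x, map_sum]
    ext j
    simp only [Matrix.vecMul, dotProduct, N, Matrix.of_apply, Finset.sum_apply]
    refine Finset.sum_congr rfl fun q _ => ?_
    rw [show (Pi.single q (x q) : ν → R) = x q • Pi.single q 1 by
      rw [← Pi.single_smul, smul_eq_mul, mul_one], map_smul]
    rfl
  let Z : Matrix (Fin s) ν R := Matrix.of fun i => (b i : ν → R)
  have hSN : S * N = 0 := by
    funext i
    rw [Matrix.mul_apply_eq_vecMul, hN]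
    have : f (S i) = 0 := by
      apply Subtype.ext
      change S i - Matrix.vecMul (Matrix.vecMul (S i) V) S = 0
      rw [← Matrix.mul_apply_eq_vecMul, h, ← Matrix.mul_apply_eq_vecMul, Matrix.one_mul, sub_self]
    simp only [g, LinearMap.comp_apply, this, map_zero]
    rfl
  have hZV : Z * V = 0 := by
    funext i
    rw [Matrix.mul_apply_eq_vecMul]
    exact (b i).2
  have hZN : Z * N = 1 := by
    funext i
    rw [Matrix.mul_apply_eq_vecMul, hN]
    have : f (Z i) = b i := by
      apply Subtype.ext
      change Z i - Matrix.vecMul (Matrix.vecMul (Z i) V) S = b i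
      rw [← Matrix.mul_apply_eq_vecMul, hZV]
      change _ - Matrix.vecMul 0 S = _
      rw [Matrix.zero_vecMul, sub_zero]
      rfl
    simp only [g, LinearMap.comp_apply, this, LinearEquiv.coe_coe]
    ext j
    rw [Module.Basis.equivFun_self, Matrix.one_apply]
  have hsum : V * S + N * Z = 1 := by
    funext q
    have h1 : Matrix.vecMul (N q) Z = (f (Pi.single q 1) : ν → R) := by
      conv_rhs => rw [← b.sum_equivFun (f (Pi.single q 1))]
      ext j
      simp only [Matrix.vecMul, dotProduct, Z, Matrix.of_apply, Submodule.coe_sum,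
        Submodule.coe_smul, Finset.sum_apply, Pi.smul_apply, smul_eq_mul]
      rfl
    have h2 : (f (Pi.single q 1) : ν → R) =
        Pi.single q 1 - Matrix.vecMul (Matrix.vecMul (Pi.single q 1) V) S := rfl
    change (V * S) q + (N * Z) q = _
    rw [Matrix.mul_apply_eq_vecMul N, h1, h2, Matrix.single_one_vecMul,
      Matrix.mul_apply_eq_vecMul]
    simp only [Matrix.row]
    rw [add_sub_cancel]
    ext j
    simp [Matrix.one_apply, Pi.single_apply, eq_comm]
  refine ⟨s, Z, N, ?_, hSN, hZV, hZN, hsum⟩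
  -- The stacked matrices are inverse to each other on both sides, which forces equal numbers of
  -- rows and columns.
  have h1 : Matrix.fromRows S Z * Matrix.fromCols V N = 1 := by
    rw [Matrix.fromRows_mul_fromCols, h, hSN, hZV, hZN, Matrix.fromBlocks_one]
  have h2 : Matrix.fromCols V N * Matrix.fromRows S Z = 1 := by
    rw [Matrix.fromCols_mul_fromRows, hsum]
  have := Matrix.square_of_invertible _ _ h1 h2
  simpa using this

instance : CharP BLaurent 2 :=
  charP_of_injective_ringHom (f := LaurentPolynomial.C (R := ZMod 2))
    (RingHom.injective _) 2

instance : CharP BRat 2 := charP_of_injective_ringHom toRat_injective 2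

/-! ### Circuits and their matrices -/

section Circuits

variable {Q Q' : Type}

theorem Circuit.FiniteDepth.append {C C' : Circuit Q} (h : Circuit.FiniteDepth C)
    (h' : Circuit.FiniteDepth C') : Circuit.FiniteDepth (C ++ C') := by
  intro g hg
  rcases List.mem_append.mp hg with hg | hg
  · exact h g hg
  · exact h' g hg

/-- The gate `g` with its qubits relabelled. -/
def Gate.map (f : Q ↪ Q') : Gate Q → Gate Q'
  | cnot i j k h => cnot (f i) (f j) k (f.injective.ne h)
  | hadamard i => hadamard (f i)
  | phase i => phase (f i)
  | cphase i j k h => cphase (f i) (f j) k (f.injective.ne h)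
  | cphaseSelf i k h => cphaseSelf (f i) k h
  | delay i l => delay (f i) l
  | infiniteDepth i p h => infiniteDepth (f i) p h

theorem Gate.qubits_map (f : Q ↪ Q') (g : Gate Q) : (g.map f).qubits ⊆ Set.range f := by
  cases g <;> simp [Gate.map, Gate.qubits, Set.insert_subset_iff]

theorem Gate.FiniteDepth.map (f : Q ↪ Q') {g : Gate Q} (h : g.FiniteDepth) :
    (g.map f).FiniteDepth := by
  cases g <;> simp_all [Gate.map, Gate.FiniteDepth]

/-- The circuit `C` with its qubits relabelled. -/
def Circuit.map (f : Q ↪ Q') (C : Circuit Q) : Circuit Q' := List.map (Gate.map f) C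

theorem Circuit.qubits_map (f : Q ↪ Q') (C : Circuit Q) :
    ∀ g ∈ Circuit.map f C, g.qubits ⊆ Set.range f := by
  intro g hg
  obtain ⟨g, -, rfl⟩ := List.mem_map.mp hg
  exact g.qubits_map f

theorem Circuit.FiniteDepth.map (f : Q ↪ Q') {C : Circuit Q} (h : Circuit.FiniteDepth C) :
    Circuit.FiniteDepth (Circuit.map f C) := by
  intro g hg
  obtain ⟨g', hg', rfl⟩ := List.mem_map.mp hg
  exact (h g' hg').map f

/-- The conjugate transpose `Mᵀ(D⁻¹)`. -/
noncomputable def conjT {ι κ : Type*} (M : Matrix ι κ BLaurent) : Matrix κ ι BLaurent :=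
  (M.map LaurentPolynomial.invert).transpose

theorem invert_invert (f : BLaurent) :
    LaurentPolynomial.invert (LaurentPolynomial.invert f) = f :=
  LaurentPolynomial.involutive_invert f

theorem conjT_apply {ι κ : Type*} (M : Matrix ι κ BLaurent) (i : κ) (j : ι) :
    conjT M i j = LaurentPolynomial.invert (M j i) := rfl

theorem conjT_conjT {ι κ : Type*} (M : Matrix ι κ BLaurent) : conjT (conjT M) = M := by
  ext1 i j
  exact invert_invert _

theorem conjT_mul {ι κ μ : Type*} [Fintype κ] (M : Matrix ι κ BLaurent) (N : Matrix κ μ BLaurent) :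
    conjT (M * N) = conjT N * conjT M := by
  ext1 i j
  simp [conjT, Matrix.mul_apply, mul_comm]

theorem conjT_one {ι : Type*} [DecidableEq ι] : conjT (1 : Matrix ι ι BLaurent) = 1 := by
  ext1 i j
  by_cases h : i = j
  · subst h; simp [conjT]
  · simp [conjT, h, Ne.symm h]

section

variable [Fintype Q]

/-- The Pauli sequence `[z Z | x X]`, for `u = [z | x]`. -/
noncomputable def cssAct (X Z : Matrix Q Q BRat) (u : PauliRow Q) : PauliRow Q :=
  Sum.elim (Matrix.vecMul (fun q => u (Sum.inl q)) Z) (Matrix.vecMul (fun q => u (Sum.inr q)) X)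

theorem cssAct_mul (X X' Z Z' : Matrix Q Q BRat) (u : PauliRow Q) :
    cssAct (X * X') (Z * Z') u = cssAct X' Z' (cssAct X Z u) := by
  simp only [cssAct, Sum.elim_inl, Sum.elim_inr, ← Matrix.vecMul_vecMul]

end

variable [DecidableEq Q']

theorem Gate.act_map_of_notMem (f : Q ↪ Q') (g : Gate Q) (u : PauliRow Q') {q : Q'}
    (hq : q ∉ Set.range f) : (g.map f).act u (Sum.inl q) = u (Sum.inl q) ∧
      (g.map f).act u (Sum.inr q) = u (Sum.inr q) := by
  have h : ∀ i, q ≠ f i := fun i hi => hq ⟨i, hi.symm⟩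
  cases g <;> simp [Gate.map, Gate.act, h]

theorem Circuit.act_map_of_notMem (f : Q ↪ Q') (C : Circuit Q) (u : PauliRow Q') {q : Q'}
    (hq : q ∉ Set.range f) : Circuit.act (Circuit.map f C) u (Sum.inl q) = u (Sum.inl q) ∧
      Circuit.act (Circuit.map f C) u (Sum.inr q) = u (Sum.inr q) := by
  induction C generalizing u with
  | nil => exact ⟨rfl, rfl⟩
  | cons g C ih =>
    have h := ih ((g.map f).act u)
    have h' := g.act_map_of_notMem f u hq
    exact ⟨h.1.trans h'.1, h.2.trans h'.2⟩

variable [DecidableEq Q]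

theorem Circuit.act_append (C C' : Circuit Q) (u : PauliRow Q) :
    Circuit.act (C ++ C') u = Circuit.act C' (Circuit.act C u) :=
  List.foldl_append ..

theorem Gate.act_map_apply (f : Q ↪ Q') (g : Gate Q) (u : PauliRow Q') (s : Q ⊕ Q) :
    (g.map f).act u (Sum.map f f s) = g.act (fun t => u (Sum.map f f t)) s := by
  cases g <;> rcases s with s | s <;>
    simp [Gate.map, Gate.act, Pi.single_apply, Function.update_apply, f.injective.eq_iff]

theorem Circuit.act_map_apply (f : Q ↪ Q') (C : Circuit Q) (u : PauliRow Q') (s : Q ⊕ Q) :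
    Circuit.act (Circuit.map f C) u (Sum.map f f s) =
      Circuit.act C (fun t => u (Sum.map f f t)) s := by
  induction C generalizing u with
  | nil => rfl
  | cons g C ih =>
    refine (ih ((g.map f).act u)).trans ?_
    change Circuit.act C _ s = Circuit.act C (g.act _) s
    congr 1
    funext t
    exact g.act_map_apply f u t

theorem transvection_map {K L : Type*} [CommRing K] [CommRing L] (f : K →+* L) (i j : Q) (a : K) :
    (Matrix.transvection i j a).map f = Matrix.transvection i j (f a) := by
  ext k l
  simp [Matrix.transvection, Matrix.one_apply, Matrix.single_apply, apply_ite f]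

/-- With `γ(D⁻¹) = D ^ l * g` and `g(0) = 1`, dividing the `X` part by `γ(D⁻¹)` is the operation `1
/ g` followed by a delay; the `Z` part is then multiplied by `γ`. A monomial `γ` is treated apart,
so that only a delay is used for it. -/
theorem exists_scaling_gate (i : Q) {γ : BLaurent} (hγ : γ ≠ 0) :
    ∃ C : Circuit Q, (∀ u, Circuit.act C u =
      Function.update (Function.update u (Sum.inl i) (toRat γ * u (Sum.inl i))) (Sum.inr i)
        (u (Sum.inr i) / toRat (LaurentPolynomial.invert γ))) ∧
      ((∃ e, γ = LaurentPolynomial.T e) → Circuit.FiniteDepth C) := by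
  by_cases h : ∃ e, γ = LaurentPolynomial.T e
  · obtain ⟨e, rfl⟩ := h
    refine ⟨[Gate.delay i e], fun u => ?_, fun _ => by
      simp [Circuit.FiniteDepth, Gate.FiniteDepth]⟩
    have h1 : toRat (LaurentPolynomial.T e) * toRat (LaurentPolynomial.T (-e)) = 1 := by
      rw [← map_mul, ← LaurentPolynomial.T_add]; simp
    have h2 : toRat (LaurentPolynomial.T (-e)) ≠ 0 := right_ne_zero_of_mul_eq_one h1
    have h3 : u (Sum.inr i) / toRat (LaurentPolynomial.invert (LaurentPolynomial.T e)) =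
        delayPow e * u (Sum.inr i) := by
      rw [LaurentPolynomial.invert_T, div_eq_iff h2, delayPow, mul_right_comm, h1, one_mul]
    rw [h3]
    rfl
  · have hγ' : LaurentPolynomial.invert γ ≠ 0 := by simpa using hγ
    obtain ⟨l, g, hl, hg⟩ := exists_eq_T_mul_toLaurent hγ'
    have hγl : γ = LaurentPolynomial.T (-l) * LaurentPolynomial.invert (Polynomial.toLaurent g) := by
      rw [← invert_invert γ, hl, map_mul, LaurentPolynomial.invert_T]
    refine ⟨[Gate.infiniteDepth i g hg, Gate.delay i (-l)], fun u => ?_, fun h' => absurd h' h⟩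
    have hl1 : toRat (LaurentPolynomial.T (-l)) * toRat (LaurentPolynomial.T l) = 1 := by
      rw [← map_mul, ← LaurentPolynomial.T_add]; simp
    have h2 : u (Sum.inr i) / toRat (LaurentPolynomial.invert γ) =
        delayPow (-l) * (u (Sum.inr i) / toRat (Polynomial.toLaurent g)) := by
      rw [hl, map_mul, delayPow, eq_inv_of_mul_eq_one_left hl1]
      field_simp
    have h3 : toRat γ * u (Sum.inl i) = delayPow (-l) *
        (toRat (LaurentPolynomial.invert (Polynomial.toLaurent g)) * u (Sum.inl i)) := by
      rw [hγl, map_mul, delayPow, mul_assoc]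
    rw [h2, h3]
    funext s
    rcases s with s | s <;> by_cases hs : s = i <;>
      simp [Circuit.act, Gate.act, hs]

theorem exists_hadamard_circuit (s : Finset Q) :
    ∃ C : Circuit Q, Circuit.FiniteDepth C ∧ ∀ u, Circuit.act C u =
      Sum.elim (fun q => if q ∈ s then u (Sum.inr q) else u (Sum.inl q))
      (fun q => if q ∈ s then u (Sum.inl q) else u (Sum.inr q)) := by
  induction s using Finset.induction_on with
  | empty =>
    refine ⟨[], by simp [Circuit.FiniteDepth], fun u => ?_⟩
    funext s
    rcases s with s | s <;> simp [Circuit.act]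
  | insert a s ha ih =>
    obtain ⟨C, hfd, hC⟩ := ih
    refine ⟨C ++ [Gate.hadamard a],
      hfd.append (by simp [Circuit.FiniteDepth, Gate.FiniteDepth]), fun u => ?_⟩
    rw [Circuit.act_append, hC]
    funext t
    rcases t with t | t <;> by_cases ht : t = a
    · subst ht; simp [Circuit.act, Gate.act, ha, -Sum.update_elim_inl, -Sum.update_elim_inr]
    · simp [Circuit.act, Gate.act, ht, -Sum.update_elim_inl, -Sum.update_elim_inr]
    · subst ht; simp [Circuit.act, Gate.act, ha, -Sum.update_elim_inl, -Sum.update_elim_inr]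
    · simp [Circuit.act, Gate.act, ht, -Sum.update_elim_inl, -Sum.update_elim_inr]

variable [Fintype Q]

theorem cssAct_one (u : PauliRow Q) : cssAct 1 1 u = u := by
  funext s
  rcases s with s | s <;> simp [cssAct]

/-- The finite-depth circuit `C` multiplies the `X` parts by `M(D)` and the `Z` parts by the inverse
conjugate transpose of `M(D)`. -/
def Implements (C : Circuit Q) (M : Matrix Q Q BLaurent) : Prop :=
  Circuit.FiniteDepth C ∧ ∃ M' : Matrix Q Q BLaurent, M * conjT M' = 1 ∧
    ∀ u, Circuit.act C u = cssAct (M.map toRat) (M'.map toRat) u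

theorem Implements.mul {C C' : Circuit Q} {M N : Matrix Q Q BLaurent} (h : Implements C M)
    (h' : Implements C' N) : Implements (C ++ C') (M * N) := by
  obtain ⟨hC, M', hM, hu⟩ := h
  obtain ⟨hC', N', hN, hu'⟩ := h'
  refine ⟨hC.append hC', M' * N', ?_, fun u => ?_⟩
  · rw [conjT_mul, Matrix.mul_assoc, ← Matrix.mul_assoc N, hN, Matrix.one_mul, hM]
  · rw [Circuit.act_append, hu, hu', Matrix.map_mul, Matrix.map_mul, cssAct_mul]

theorem Implements.one : Implements ([] : Circuit Q) 1 :=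
  ⟨by simp [Circuit.FiniteDepth], 1, by simp [conjT_one], fun u => by
    simp [Matrix.map_one, cssAct_one, Circuit.act]⟩

theorem vecMul_transvection {K : Type*} [CommRing K] (x : Q → K) (i j : Q) (a : K) (q : Q) :
    Matrix.vecMul x (Matrix.transvection i j a) q = x q + if q = j then x i * a else 0 := by
  rw [Matrix.transvection, Matrix.vecMul_add, Matrix.vecMul_one, Pi.add_apply]
  congr 1
  simp only [Matrix.vecMul, dotProduct, Matrix.single_apply]
  by_cases h : q = j
  · subst h; simp
  · simp [h, Ne.symm h]

theorem implements_cnot {i j : Q} (hij : i ≠ j) (k : ℤ) :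
    Implements [Gate.cnot i j k hij] (Matrix.transvection i j (LaurentPolynomial.T k)) := by
  refine ⟨by simp [Circuit.FiniteDepth, Gate.FiniteDepth],
    Matrix.transvection j i (LaurentPolynomial.T (-k)), ?_, fun u => ?_⟩
  · have h : conjT (Matrix.transvection j i (LaurentPolynomial.T (-k))) =
        Matrix.transvection i j (LaurentPolynomial.T k : BLaurent) := by
      ext1 a b
      simp only [conjT_apply, Matrix.transvection, Matrix.add_apply, Matrix.one_apply,
        Matrix.single_apply, map_add, apply_ite LaurentPolynomial.invert, map_one, map_zero,
        LaurentPolynomial.invert_T, neg_neg]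
      congr 1
      · simp [eq_comm]
      · simp [and_comm]
    rw [h, Matrix.transvection_mul_transvection_same _ _ hij, CharTwo.add_self_eq_zero,
      Matrix.transvection_zero]
  · funext s
    rcases s with s | s
    · simp [Circuit.act, Gate.act, cssAct, transvection_map, vecMul_transvection, Pi.single_apply,
        delayPow, mul_comm]
    · simp [Circuit.act, Gate.act, cssAct, transvection_map, vecMul_transvection, Pi.single_apply,
        delayPow, mul_comm]

/-- Transvections at a fixed position multiply by adding their parameters, so each monomial of `a`
contributes one CNOT. -/
theorem exists_implements_transvection {i j : Q} (hij : i ≠ j) (a : BLaurent) :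
    ∃ C, Implements C (Matrix.transvection i j a) := by
  induction a using LaurentPolynomial.induction_on' with
  | add p q hp hq =>
    obtain ⟨C, hC⟩ := hp
    obtain ⟨C', hC'⟩ := hq
    exact ⟨C ++ C', by
      rw [← Matrix.transvection_mul_transvection_same _ _ hij]; exact hC.mul hC'⟩
  | C_mul_T n a =>
    obtain rfl | rfl : a = 0 ∨ a = 1 := by revert a; decide
    · exact ⟨[], by simpa using Implements.one⟩
    · exact ⟨_, by simpa using implements_cnot hij n⟩

theorem exists_scaling_circuit (γ : Q → BLaurent) (hγ : ∀ q, γ q ≠ 0) :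
    ∃ C : Circuit Q, (∀ u, Circuit.act C u = Sum.elim (fun q => toRat (γ q) * u (Sum.inl q))
      (fun q => u (Sum.inr q) / toRat (LaurentPolynomial.invert (γ q)))) ∧
      ((∀ q, ∃ e, γ q = LaurentPolynomial.T e) → Circuit.FiniteDepth C) := by
  suffices h : ∀ s : Finset Q, ∃ C : Circuit Q, (∀ u, Circuit.act C u =
      Sum.elim (fun q => if q ∈ s then toRat (γ q) * u (Sum.inl q) else u (Sum.inl q))
      (fun q => if q ∈ s then u (Sum.inr q) / toRat (LaurentPolynomial.invert (γ q))
        else u (Sum.inr q))) ∧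
      ((∀ q, ∃ e, γ q = LaurentPolynomial.T e) → Circuit.FiniteDepth C) by
    simpa using h Finset.univ
  intro s
  induction s using Finset.induction_on with
  | empty =>
    refine ⟨[], fun u => ?_, fun _ => by simp [Circuit.FiniteDepth]⟩
    funext s
    rcases s with s | s <;> simp [Circuit.act]
  | insert a s ha ih =>
    obtain ⟨C, hC, hfd⟩ := ih
    obtain ⟨C', hC', hfd'⟩ := exists_scaling_gate a (hγ a)
    refine ⟨C ++ C', fun u => ?_, fun h => (hfd h).append (hfd' (h a))⟩
    rw [Circuit.act_append, hC', hC]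
    funext t
    rcases t with t | t <;> by_cases ht : t = a
    · subst ht; simp [ha, -Sum.update_elim_inl, -Sum.update_elim_inr]
    · simp [ht, -Sum.update_elim_inl, -Sum.update_elim_inr]
    · subst ht; simp [ha, -Sum.update_elim_inl, -Sum.update_elim_inr]
    · simp [ht, -Sum.update_elim_inl, -Sum.update_elim_inr]

theorem exists_implements_diagonal (e : Q → ℤ) :
    ∃ C, Implements C (Matrix.diagonal fun q : Q => LaurentPolynomial.T (e q)) := by
  obtain ⟨C, hC, hfd⟩ := exists_scaling_circuit (fun q => LaurentPolynomial.T (e q))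
    fun q => (LaurentPolynomial.isUnit_T _).ne_zero
  refine ⟨C, hfd fun q => ⟨_, rfl⟩, Matrix.diagonal fun q : Q => LaurentPolynomial.T (e q), ?_, ?_⟩
  · have : conjT (Matrix.diagonal fun q : Q => (LaurentPolynomial.T (e q) : BLaurent)) =
        Matrix.diagonal fun q => LaurentPolynomial.T (-e q) := by
      ext1 i j
      by_cases h : i = j
      · subst h; simp [conjT]
      · simp [conjT, h, Ne.symm h]
    rw [this, Matrix.diagonal_mul_diagonal, ← Matrix.diagonal_one]
    congr 1
    funext q
    rw [← LaurentPolynomial.T_add]; simp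
  · intro u
    rw [hC]
    funext t
    rcases t with t | t
    · simp [cssAct, Matrix.diagonal_map, Matrix.vecMul_diagonal, mul_comm]
    · have h1 : toRat (LaurentPolynomial.T (e t)) * toRat (LaurentPolynomial.T (-e t)) = 1 := by
        rw [← map_mul, ← LaurentPolynomial.T_add]; simp
      have h2 : toRat (LaurentPolynomial.T (-e t)) ≠ 0 := right_ne_zero_of_mul_eq_one h1
      simp [cssAct, Matrix.diagonal_map, Matrix.vecMul_diagonal]
      rw [div_eq_iff h2, mul_assoc, h1, mul_one]

theorem exists_implements_fin {n : ℕ} {M : Matrix (Fin n) (Fin n) BLaurent} (hM : IsUnit M) :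
    ∃ C, Implements C M := by
  have h := mem_circuitMatrices_of_isUnit hM
  induction h using Submonoid.closure_induction with
  | mem A hA =>
    rcases hA with ⟨i, j, hij, a, rfl⟩ | ⟨e, rfl⟩
    · exact exists_implements_transvection hij a
    · exact exists_implements_diagonal e
  | one => exact ⟨[], .one⟩
  | mul A B hA hB ihA ihB =>
    rw [Matrix.isUnit_iff_isUnit_det, Matrix.det_mul] at hM
    obtain ⟨C, hC⟩ := ihA ((Matrix.isUnit_iff_isUnit_det _).mpr (isUnit_of_mul_isUnit_left hM))
    obtain ⟨C', hC'⟩ := ihB ((Matrix.isUnit_iff_isUnit_det _).mpr (isUnit_of_mul_isUnit_right hM))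
    exact ⟨C ++ C', hC.mul hC'⟩

/-- Every invertible matrix of Laurent polynomials is performed by a finite-depth circuit. -/
theorem exists_circuit_of_mul_eq_one {M N : Matrix Q Q BLaurent} (h : M * N = 1) :
    ∃ C : Circuit Q, Circuit.FiniteDepth C ∧
      ∀ u, Circuit.act C u = cssAct (M.map toRat) ((conjT N).map toRat) u := by
  let e := Fintype.equivFin Q
  have hMN : M.submatrix e.symm e.symm * N.submatrix e.symm e.symm = 1 := by
    rw [Matrix.submatrix_mul_equiv, h, Matrix.submatrix_one_equiv]
  obtain ⟨C, hC, M', hM', hu⟩ := exists_implements_fin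
    ((Matrix.isUnit_iff_isUnit_det _).mpr (Matrix.isUnit_det_of_right_inverse hMN))
  -- The action on `Z` parts is determined by that on `X` parts, because `M * conjT M' = 1`.
  have hM'' : M' = conjT (N.submatrix e.symm e.symm) := by
    rw [← conjT_conjT M']
    congr 1
    rw [← Matrix.one_mul (conjT M'), ← mul_eq_one_comm.mp hMN, Matrix.mul_assoc, hM',
      Matrix.mul_one]
  refine ⟨Circuit.map e.symm.toEmbedding C, hC.map _, fun u => ?_⟩
  have key : ∀ s, Circuit.act (Circuit.map e.symm.toEmbedding C) u (Sum.map e.symm e.symm s) =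
      cssAct (M.map toRat) ((conjT N).map toRat) u (Sum.map e.symm e.symm s) := by
    intro s
    refine (Circuit.act_map_apply e.symm.toEmbedding C u s).trans ?_
    rw [hu, hM'']
    rcases s with s | s
    · simp only [cssAct, Sum.elim_inl, Sum.map_inl, Matrix.vecMul, dotProduct]
      exact e.symm.sum_comp (fun q => u (Sum.inl q) * ((conjT N).map toRat) q (e.symm s))
    · simp only [cssAct, Sum.elim_inr, Sum.map_inr, Matrix.vecMul, dotProduct]
      exact e.symm.sum_comp (fun q => u (Sum.inr q) * (M.map toRat) q (e.symm s))
  funext s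
  have := key (Sum.map e e s)
  simpa [Sum.map_map] using this

end Circuits

/-! ### Linearity of circuits, and rows split between receiver and sender -/

section Rows

variable {Q Q' : Type}

theorem Gate.act_add [DecidableEq Q] (g : Gate Q) (u v : PauliRow Q) :
    g.act (u + v) = g.act u + g.act v := by
  cases g <;> funext s <;> rcases s with s | s <;>
    simp only [Gate.act, Pi.add_apply, Pi.single_apply, Function.update_apply] <;>
    split_ifs <;> ring

theorem Gate.act_smul [DecidableEq Q] (g : Gate Q) (r : BRat) (u : PauliRow Q) :
    g.act (r • u) = r • g.act u := by
  cases g <;> funext s <;> rcases s with s | s <;>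
    simp only [Gate.act, Pi.add_apply, Pi.smul_apply, Pi.single_apply, Function.update_apply,
      smul_eq_mul] <;>
    split_ifs <;> ring

theorem Circuit.act_add [DecidableEq Q] (C : Circuit Q) (u v : PauliRow Q) :
    Circuit.act C (u + v) = Circuit.act C u + Circuit.act C v := by
  induction C generalizing u v with
  | nil => rfl
  | cons g C ih =>
    change Circuit.act C (g.act (u + v)) = _
    rw [g.act_add, ih]
    rfl

theorem Circuit.act_smul [DecidableEq Q] (C : Circuit Q) (r : BRat) (u : PauliRow Q) :
    Circuit.act C (r • u) = r • Circuit.act C u := by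
  induction C generalizing u with
  | nil => rfl
  | cons g C ih =>
    change Circuit.act C (g.act (r • u)) = _
    rw [g.act_smul, ih]
    rfl

theorem Circuit.act_sum [DecidableEq Q] (C : Circuit Q) {ι : Type*} (s : Finset ι)
    (u : ι → PauliRow Q) : Circuit.act C (∑ i ∈ s, u i) = ∑ i ∈ s, Circuit.act C (u i) := by
  classical
  induction s using Finset.induction_on with
  | empty => simpa using Circuit.act_smul C 0 0
  | insert a s ha ih => rw [Finset.sum_insert ha, Finset.sum_insert ha, Circuit.act_add, ih]

/-- The `Z`-type sequence with exponents `v`. -/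
noncomputable def zRow (v : Q → BRat) : PauliRow Q := Sum.elim v 0

/-- The `X`-type sequence with exponents `v`. -/
noncomputable def xRow (v : Q → BRat) : PauliRow Q := Sum.elim 0 v

theorem cssAct_zRow [Fintype Q] (X Z : Matrix Q Q BRat) (v : Q → BRat) :
    cssAct X Z (zRow v) = zRow (Matrix.vecMul v Z) := by
  funext s
  rcases s with s | s <;> simp [cssAct, zRow, Matrix.vecMul, dotProduct]

theorem cssAct_xRow [Fintype Q] (X Z : Matrix Q Q BRat) (v : Q → BRat) :
    cssAct X Z (xRow v) = xRow (Matrix.vecMul v X) := by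
  funext s
  rcases s with s | s <;> simp [cssAct, xRow, Matrix.vecMul, dotProduct]

theorem pauliZ_eq_zRow [DecidableEq Q] (q : Q) : pauliZ q = zRow (Pi.single q 1) := by
  funext s
  rcases s with s | s <;> simp [pauliZ, zRow, Pi.single_apply]

theorem pauliX_eq_xRow [DecidableEq Q] (q : Q) : pauliX q = xRow (Pi.single q 1) := by
  funext s
  rcases s with s | s <;> simp [pauliX, xRow, Pi.single_apply]

/-- The sequence with the parts `u` and `v` on two sets of qubits. -/
noncomputable def joinRow (u : PauliRow Q) (v : PauliRow Q') : PauliRow (Q ⊕ Q') :=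
  Sum.elim (Sum.elim (fun q => u (Sum.inl q)) (fun q => v (Sum.inl q)))
    (Sum.elim (fun q => u (Sum.inr q)) (fun q => v (Sum.inr q)))

theorem joinRow_add (u u' : PauliRow Q) (v v' : PauliRow Q') :
    joinRow (u + u') (v + v') = joinRow u v + joinRow u' v' := by
  funext s
  rcases s with (s | s) | (s | s) <;> simp [joinRow]

theorem joinRow_smul (r : BRat) (u : PauliRow Q) (v : PauliRow Q') :
    joinRow (r • u) (r • v) = r • joinRow u v := by
  funext s
  rcases s with (s | s) | (s | s) <;> simp [joinRow]

theorem joinRow_sum {ι : Type*} (s : Finset ι) (u : ι → PauliRow Q) (v : ι → PauliRow Q') :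
    joinRow (∑ i ∈ s, u i) (∑ i ∈ s, v i) = ∑ i ∈ s, joinRow (u i) (v i) := by
  funext t
  rcases t with (t | t) | (t | t) <;> simp [joinRow, Finset.sum_apply]

theorem act_map_joinRow [DecidableEq Q] [DecidableEq Q'] (C : Circuit Q') (u : PauliRow Q)
    (v : PauliRow Q') :
    Circuit.act (Circuit.map (Function.Embedding.inr : Q' ↪ Q ⊕ Q') C) (joinRow u v) =
      joinRow u (Circuit.act C v) := by
  have h1 : ∀ s, (joinRow u v) (Sum.map Sum.inr Sum.inr s) = v s := by
    rintro (s | s) <;> rfl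
  have h2 : ∀ s, Circuit.act (Circuit.map (Function.Embedding.inr : Q' ↪ Q ⊕ Q') C) (joinRow u v)
      (Sum.map Sum.inr Sum.inr s) = Circuit.act C v s := fun s =>
    (Circuit.act_map_apply Function.Embedding.inr C (joinRow u v) s).trans
      (congrFun (congrArg (Circuit.act C) (funext h1)) s)
  have h3 : ∀ q : Q, (Sum.inl q : Q ⊕ Q') ∉ Set.range (Function.Embedding.inr : Q' ↪ Q ⊕ Q') := by
    rintro q ⟨q', h⟩
    exact Sum.inr_ne_inl h
  funext s
  rcases s with (s | s) | (s | s)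
  · exact (Circuit.act_map_of_notMem _ C _ (h3 s)).1
  · exact h2 (Sum.inl s)
  · exact (Circuit.act_map_of_notMem _ C _ (h3 s)).2
  · exact h2 (Sum.inr s)

end Rows

/-! ### A frame adapted to the check matrices -/

/-- Regroups the ebit halves, the two kinds of ancilla qubits and the information qubits. -/
def regroup (α β γ δ : Type*) : α ⊕ ((β ⊕ γ) ⊕ δ) ≃ ((α ⊕ γ) ⊕ β) ⊕ δ where
  toFun
    | .inl a => .inl (.inl (.inl a))
    | .inr (.inl (.inl b)) => .inl (.inr b)
    | .inr (.inl (.inr c)) => .inl (.inl (.inr c))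
    | .inr (.inr d) => .inr d
  invFun
    | .inl (.inl (.inl a)) => .inl a
    | .inl (.inr b) => .inr (.inl (.inl b))
    | .inl (.inl (.inr c)) => .inr (.inl (.inr c))
    | .inr d => .inr (.inr d)
  left_inv := by rintro (_ | ((_ | _) | _)) <;> rfl
  right_inv := by rintro (((_ | _) | _) | _) <;> rfl

variable {n c a₁ a₂ : ℕ}

/-- The rows of `T` are the images of `X` on the sender's qubits: `H₂` on ebits and on ancillas of
the second kind, rows dual to the commuting rows of `H₁` on ancillas of the first kind, and a
complement on information qubits. `H₁ * conjT T` lists the coordinates of `H₁` in the dual basis,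
that of the images of `Z`. `P` records the overlap of the complement with the first `c` rows of
`H₁`; it need not vanish. -/
theorem exists_frame_matrix
    (H₁ : Matrix (Fin c ⊕ Fin a₁) (Fin n) BLaurent) (K₁ : Matrix (Fin n) (Fin c ⊕ Fin a₁) BLaurent)
    (H₂ : Matrix (Fin c ⊕ Fin a₂) (Fin n) BLaurent) (K₂ : Matrix (Fin n) (Fin c ⊕ Fin a₂) BLaurent)
    (hK₁ : H₁ * K₁ = 1) (hK₂ : H₂ * K₂ = 1) (γ : Fin c → BLaurent)
    (hH : H₁ * conjT H₂ = Matrix.fromBlocks (Matrix.diagonal γ) 0 0 0) :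
    ∃ (k : ℕ) (T : Matrix (Fin c ⊕ ((Fin a₁ ⊕ Fin a₂) ⊕ Fin k)) (Fin n) BLaurent)
      (T' : Matrix (Fin n) (Fin c ⊕ ((Fin a₁ ⊕ Fin a₂) ⊕ Fin k)) BLaurent)
      (P : Matrix (Fin k) (Fin c) BLaurent),
      c + a₁ + a₂ + k = n ∧ T * T' = 1 ∧ T' * T = 1 ∧
      (∀ a, T (.inl a) = H₂ (.inl a)) ∧ (∀ b, T (.inr (.inl (.inr b))) = H₂ (.inr b)) ∧
      (∀ a, (H₁ * conjT T) (.inl a) =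
        Sum.elim (Pi.single a (γ a)) (Sum.elim 0 (conjT P a))) ∧
      (∀ b, (H₁ * conjT T) (.inr b) = Pi.single (.inr (.inl (.inl b))) 1) := by
  have hℓ : conjT K₁ * conjT H₁ = 1 := by rw [← conjT_mul, hK₁, conjT_one]
  have hΔ : H₂ * conjT H₁ = conjT (Matrix.fromBlocks (Matrix.diagonal γ) 0 0 0) := by
    rw [← hH, conjT_mul, conjT_conjT]
  -- The columns of `l` are the commuting rows of `H₁`, conjugated; the rows of `W`, from the right
  -- inverse, are dual to them.
  let l : Matrix (Fin n) (Fin a₁) BLaurent := (conjT H₁).submatrix id Sum.inr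
  let W : Matrix (Fin a₁) (Fin n) BLaurent := (conjT K₁).submatrix Sum.inr id
  have hWH : ∀ b i, (W * conjT H₁) b i = (1 : Matrix (Fin c ⊕ Fin a₁) _ BLaurent) (.inr b) i := by
    intro b i
    rw [← hℓ]; rfl
  have hWl : W * l = 1 := by
    ext1 b b'
    refine (hWH b (.inr b')).trans ?_
    simp [Matrix.one_apply]
  have hHl : H₂ * l = 0 := by
    ext1 j b
    refine (congrFun (congrFun hΔ j) (.inr b)).trans ?_
    rcases j with j | j <;> simp [conjT_apply]
  -- `1 - l * W` corrects `K₂` so that `W` annihilates it. Since `H₂ * l = 0`, it remains a right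
  -- inverse of `H₂`.
  have hSV : Matrix.fromRows H₂ W * Matrix.fromCols ((1 - l * W) * K₂) l = 1 := by
    have h1 : H₂ * ((1 - l * W) * K₂) = 1 := by
      rw [← Matrix.mul_assoc, Matrix.mul_sub, ← Matrix.mul_assoc, hHl, Matrix.zero_mul,
        Matrix.mul_one, sub_zero, hK₂]
    have h2 : W * ((1 - l * W) * K₂) = 0 := by
      rw [← Matrix.mul_assoc, Matrix.mul_sub, ← Matrix.mul_assoc, hWl, Matrix.one_mul,
        Matrix.mul_one, sub_self, Matrix.zero_mul]
    rw [Matrix.fromRows_mul_fromCols, h1, h2, hWl, hHl, Matrix.fromBlocks_one]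
  obtain ⟨k, Z, N, hk, hSN, hZV, hZN, hsum⟩ := exists_completion _ _ hSV
  have hZl : Z * l = 0 := by
    ext1 i b
    rw [Matrix.mul_fromCols] at hZV
    exact congrFun (congrFun hZV i) (.inr b)
  let T₀ := Matrix.fromRows (Matrix.fromRows H₂ W) Z
  let T₀' := Matrix.fromCols (Matrix.fromCols ((1 - l * W) * K₂) l) N
  have h1 : T₀ * T₀' = 1 := by
    rw [Matrix.fromRows_mul_fromCols, hSV, hSN, hZV, hZN, Matrix.fromBlocks_one]
  have h2 : T₀' * T₀ = 1 := by rw [Matrix.fromCols_mul_fromRows, hsum]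
  let ρ := regroup (Fin c) (Fin a₁) (Fin a₂) (Fin k)
  refine ⟨k, T₀.submatrix ρ id, T₀'.submatrix id ρ,
    Matrix.of fun i a => (Z * conjT H₁) i (.inl a), ?_, ?_, ?_, fun _ => rfl, fun _ => rfl, ?_, ?_⟩
  · simp at hk; omega
  · rw [← Matrix.submatrix_mul _ _ _ _ _ Function.bijective_id, h1, Matrix.submatrix_one_equiv]
  · rw [Matrix.submatrix_mul_equiv, h2, Matrix.submatrix_id_id]
  all_goals
    have hT : ∀ i j, (H₁ * conjT (T₀.submatrix ρ id)) i j =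
        LaurentPolynomial.invert ((T₀ * conjT H₁) (ρ j) i) := by
      intro i j
      rw [← conjT_apply, conjT_mul, conjT_conjT]; rfl
    have hT₂ : ∀ j i, (T₀ * conjT H₁) (.inl (.inl j)) i = _ := fun j i =>
      congrFun (congrFun hΔ j) i
    have hTW : ∀ b i, (T₀ * conjT H₁) (.inl (.inr b)) i = _ := hWH
    have hTZ : ∀ q b, (T₀ * conjT H₁) (.inr q) (.inr b) = 0 := fun q b =>
      congrFun (congrFun hZl q) b
  · intro a
    funext j
    rw [hT]
    rcases j with j | ((j | j) | j)
    · change LaurentPolynomial.invert ((T₀ * conjT H₁) (.inl (.inl (.inl j))) _) = _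
      rw [hT₂, conjT_apply, invert_invert]
      simp [Matrix.diagonal_apply, Pi.single_apply, eq_comm]
    · change LaurentPolynomial.invert ((T₀ * conjT H₁) (.inl (.inr j)) _) = _
      rw [hTW]; simp
    · change LaurentPolynomial.invert ((T₀ * conjT H₁) (.inl (.inl (.inr j))) _) = _
      rw [hT₂, conjT_apply, invert_invert]; simp
    · rfl
  · intro a
    funext j
    rw [hT]
    rcases j with j | ((j | j) | j)
    · change LaurentPolynomial.invert ((T₀ * conjT H₁) (.inl (.inl (.inl j))) _) = _
      rw [hT₂, conjT_apply, invert_invert]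
      simp
    · change LaurentPolynomial.invert ((T₀ * conjT H₁) (.inl (.inr j)) _) = _
      rw [hTW]; simp [Matrix.one_apply, Pi.single_apply]
    · change LaurentPolynomial.invert ((T₀ * conjT H₁) (.inl (.inl (.inr j))) _) = _
      rw [hT₂, conjT_apply, invert_invert]; simp
    · change LaurentPolynomial.invert ((T₀ * conjT H₁) (.inr j) _) = _
      rw [hTZ]; simp

theorem vecMul_map_toRat {ι κ : Type*} [Fintype ι] (v : ι → BLaurent) (M : Matrix ι κ BLaurent) :
    Matrix.vecMul (fun i => toRat (v i)) (M.map toRat) = fun j => toRat (Matrix.vecMul v M j) := by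
  funext j
  exact (RingHom.map_vecMul toRat M v j).symm

theorem act_map_equiv {Q Q' : Type} [DecidableEq Q] [DecidableEq Q'] (e : Q ≃ Q') (C : Circuit Q)
    (u : PauliRow Q) :
    Circuit.act (Circuit.map e.toEmbedding C) (fun s => u (Sum.map e.symm e.symm s)) =
      fun s => Circuit.act C u (Sum.map e.symm e.symm s) := by
  funext s
  have h := Circuit.act_map_apply e.toEmbedding C (fun s => u (Sum.map e.symm e.symm s))
    (Sum.map e.symm e.symm s)
  simpa [Sum.map_map] using h

/-- The matrix that adds the multiples `F` of the rows of the first block to those of the second. -/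
noncomputable def lowerShear {α β : Type*} [DecidableEq α] [DecidableEq β] (F : Matrix β α BLaurent) :
    Matrix (α ⊕ β) (α ⊕ β) BLaurent :=
  Matrix.fromBlocks 1 0 F 1

theorem lowerShear_mul_self {α β : Type*} [DecidableEq α] [DecidableEq β] [Fintype α] [Fintype β]
    (F : Matrix β α BLaurent) : lowerShear F * lowerShear F = 1 := by
  have h : F + F = 0 := by
    ext1 i j
    exact CharTwo.add_self_eq_zero _
  simp [lowerShear, Matrix.fromBlocks_multiply, h]

theorem conjT_lowerShear {α β : Type*} [DecidableEq α] [DecidableEq β] (F : Matrix β α BLaurent) :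
    conjT (lowerShear F) = Matrix.fromBlocks 1 (conjT F) 0 1 := by
  ext1 i j
  rcases i with i | i <;> rcases j with j | j <;>
    simp [conjT, lowerShear, Matrix.one_apply, apply_ite LaurentPolynomial.invert, eq_comm]

/-! ### Encoding and decoding circuits -/

section Frame

variable {n c a₁ a₂ k : ℕ}

/-- The sender's qubits of a frame: halves of ebits, ancilla qubits for the `Z`-type and for the
`X`-type checks, and information qubits. -/
abbrev SenderQubits (c a₁ a₂ k : ℕ) : Type := Fin c ⊕ ((Fin a₁ ⊕ Fin a₂) ⊕ Fin k)

/-- This circuit produces the coordinates of the checks before `T` is applied. The image of an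
information `X` is stated relative to the images of the ebit `X`, since this is the form in which
the stabilizer removes its infinite-weight part. -/
theorem exists_precoder (γ : Fin c → BLaurent) (hγ : ∀ a, γ a ≠ 0)
    (P : Matrix (Fin k) (Fin c) BLaurent) :
    ∃ C : Circuit (SenderQubits c a₁ a₂ k),
      (∀ a, Circuit.act C (pauliZ (.inl a)) = zRow (fun q => toRat
        ((Sum.elim (Pi.single a (γ a)) (Sum.elim 0 (conjT P a)) : SenderQubits c a₁ a₂ k → BLaurent)
          q))) ∧
      (∀ b, Circuit.act C (pauliZ (.inr (.inl (.inl b)))) =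
        zRow (Pi.single (.inr (.inl (.inl b))) 1)) ∧
      (∀ a, Circuit.act C (pauliX (.inl a)) =
        xRow ((toRat (LaurentPolynomial.invert (γ a)))⁻¹ • Pi.single (.inl a) 1)) ∧
      (∀ b, Circuit.act C (pauliZ (.inr (.inl (.inr b)))) =
        xRow (Pi.single (.inr (.inl (.inr b))) 1)) ∧
      (∀ i, Circuit.act C (pauliX (.inr (.inr i))) = xRow (Pi.single (.inr (.inr i)) 1) +
        ∑ a, toRat (P i a) • Circuit.act C (pauliX (.inl a))) ∧
      (∀ i, Circuit.act C (pauliZ (.inr (.inr i))) = zRow (Pi.single (.inr (.inr i)) 1)) ∧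
      ((∀ a, ∃ m, γ a = LaurentPolynomial.T m) → Circuit.FiniteDepth C) := by
  -- The ancillas of the `X`-type checks: a Hadamard turns their stabilizer `Z` into `X`.
  let s : Finset (SenderQubits c a₁ a₂ k) := Finset.univ.image fun b => .inr (.inl (.inr b))
  obtain ⟨C₁, hfd₁, hC₁⟩ := exists_hadamard_circuit s
  -- CNOTs from information qubits to ebit halves: they add `P` to the information `X` and, dually,
  -- `P†` to the ebit `Z`.
  let F : Matrix ((Fin a₁ ⊕ Fin a₂) ⊕ Fin k) (Fin c) BLaurent := Matrix.fromRows 0 P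
  obtain ⟨C₂, hfd₂, hC₂⟩ := exists_circuit_of_mul_eq_one (lowerShear_mul_self F)
  -- Only ebit halves are scaled. As this follows the CNOTs, the terms `P†` on information qubits
  -- stay unscaled.
  let γ' : SenderQubits c a₁ a₂ k → BLaurent := Sum.elim γ 1
  obtain ⟨C₃, hC₃, hfd₃⟩ := exists_scaling_circuit γ' (by
    rintro (a | q)
    · exact hγ a
    · exact one_ne_zero)
  have hfix : ∀ q, q ∉ s → Circuit.act C₁ (pauliZ q) = pauliZ q ∧
      Circuit.act C₁ (pauliX q) = pauliX q := by
    intro q hq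
    rw [hC₁, hC₁]
    constructor <;> funext t <;> rcases t with t | t <;> by_cases ht : t ∈ s
    all_goals
      have : t ∈ s → t ≠ q := fun h h' => hq (h' ▸ h)
      simp [pauliZ, pauliX, ht, Pi.single_apply, this]
  have hswap : ∀ q, q ∈ s → Circuit.act C₁ (pauliZ q) = pauliX q := by
    intro q hq
    rw [hC₁]
    funext t
    rcases t with t | t <;> by_cases ht : t ∈ s
    all_goals
      have : t ∉ s → t ≠ q := fun h h' => h (h' ▸ hq)
      simp [pauliZ, pauliX, ht, Pi.single_apply, this]
  have hz : ∀ q, Circuit.act C₃ (Circuit.act C₂ (pauliZ q)) =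
      zRow (fun t => toRat (γ' t * conjT (lowerShear F) q t)) := by
    intro q
    rw [pauliZ_eq_zRow, hC₂, cssAct_zRow, hC₃, Matrix.single_one_vecMul]
    funext t
    rcases t with t | t <;> simp [zRow, Matrix.row]
  have hx : ∀ q, Circuit.act C₃ (Circuit.act C₂ (pauliX q)) =
      xRow (fun t => toRat (lowerShear F q t) / toRat (LaurentPolynomial.invert (γ' t))) := by
    intro q
    rw [pauliX_eq_xRow, hC₂, cssAct_xRow, hC₃, Matrix.single_one_vecMul]
    funext t
    rcases t with t | t <;> simp [xRow, Matrix.row]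
  have hs : ∀ q, q ∈ s ↔ ∃ b, Sum.inr (Sum.inl (Sum.inr b)) = q := by simp [s]
  have hX : ∀ a, Circuit.act (C₁ ++ C₂ ++ C₃) (pauliX (.inl a)) =
        xRow ((toRat (LaurentPolynomial.invert (γ a)))⁻¹ • Pi.single (.inl a) 1) := by
    intro a
    rw [Circuit.act_append, Circuit.act_append, (hfix _ (by simp [hs])).2, hx]
    congr 1
    funext t
    rcases t with t | t
    · by_cases h : a = t
      · subst h; simp [lowerShear, γ']
      · simp [lowerShear, γ', h, Ne.symm h]
    · simp [lowerShear]
  refine ⟨C₁ ++ C₂ ++ C₃, ?_, ?_, hX, ?_, ?_, ?_, ?_⟩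
  · intro a
    rw [Circuit.act_append, Circuit.act_append, (hfix _ (by simp [hs])).1, hz]
    congr 1
    funext t
    rw [conjT_lowerShear]
    rcases t with t | ((t | t) | t)
    · by_cases h : a = t
      · subst h; simp [γ']
      · simp [γ', h, Ne.symm h]
    · simp [γ', F, conjT_apply]
    · simp [γ', F, conjT_apply]
    · simp [γ', F, conjT_apply]
  · intro b
    rw [Circuit.act_append, Circuit.act_append, (hfix _ (by simp [hs])).1, hz]
    congr 1
    funext t
    rw [conjT_lowerShear]
    rcases t with t | t
    · simp
    · simp [γ', Matrix.one_apply, Pi.single_apply, eq_comm, apply_ite toRat]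
  · intro b
    rw [Circuit.act_append, Circuit.act_append, hswap _ (by simp [hs]), hx]
    congr 1
    funext t
    rcases t with t | t
    · simp [lowerShear, F]
    · simp [lowerShear, γ', Matrix.one_apply, Pi.single_apply, eq_comm, apply_ite toRat]
  · intro i
    simp only [hX]
    rw [Circuit.act_append, Circuit.act_append, (hfix _ (by simp [hs])).2, hx]
    funext t
    rcases t with t | t
    · simp [xRow, Finset.sum_apply]
    · rcases t with t | t
      · simp [xRow, Finset.sum_apply, lowerShear, F, γ', Pi.single_apply, div_eq_mul_inv]
      · simp [xRow, Finset.sum_apply, lowerShear, γ', Matrix.one_apply, Pi.single_apply, eq_comm,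
          apply_ite toRat]
  · intro i
    rw [Circuit.act_append, Circuit.act_append, (hfix _ (by simp [hs])).1, hz]
    congr 1
    funext t
    rw [conjT_lowerShear]
    rcases t with t | t
    · simp
    · simp [γ', Matrix.one_apply, Pi.single_apply, eq_comm, apply_ite toRat]
  · intro h
    refine (hfd₁.append hfd₂).append (hfd₃ ?_)
    rintro (a | q)
    · exact h a
    · exact ⟨0, LaurentPolynomial.T_zero.symm⟩

/-- The precoder is followed by the circuit of `T`. The image of an ebit `X` is a row of `H₂`
divided by `γ_a(D⁻¹)`, whence the factor in the third claim. -/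
theorem exists_encoder (e : SenderQubits c a₁ a₂ k ≃ Fin n) {γ : Fin c → BLaurent}
    (hγ : ∀ a, γ a ≠ 0) {H₁ : Matrix (Fin c ⊕ Fin a₁) (Fin n) BLaurent}
    {H₂ : Matrix (Fin c ⊕ Fin a₂) (Fin n) BLaurent}
    {T : Matrix (SenderQubits c a₁ a₂ k) (Fin n) BLaurent}
    {T' : Matrix (Fin n) (SenderQubits c a₁ a₂ k) BLaurent} {P : Matrix (Fin k) (Fin c) BLaurent}
    (hTT' : T * T' = 1) (hT'T : T' * T = 1)
    (hc : ∀ a, T (.inl a) = H₂ (.inl a)) (hx : ∀ b, T (.inr (.inl (.inr b))) = H₂ (.inr b))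
    (hH : ∀ a, (H₁ * conjT T) (.inl a) = Sum.elim (Pi.single a (γ a)) (Sum.elim 0 (conjT P a)))
    (hz : ∀ b, (H₁ * conjT T) (.inr b) = Pi.single (.inr (.inl (.inl b))) 1) :
    ∃ C : Circuit (Fin n),
      (∀ a, Circuit.act C (pauliZ (e (.inl a))) = zRow fun q => toRat (H₁ (.inl a) q)) ∧
      (∀ b, Circuit.act C (pauliZ (e (.inr (.inl (.inl b))))) =
        zRow fun q => toRat (H₁ (.inr b) q)) ∧
      (∀ a, toRat (LaurentPolynomial.invert (γ a)) • Circuit.act C (pauliX (e (.inl a))) =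
        xRow fun q => toRat (H₂ (.inl a) q)) ∧
      (∀ b, Circuit.act C (pauliZ (e (.inr (.inl (.inr b))))) =
        xRow fun q => toRat (H₂ (.inr b) q)) ∧
      (∀ i, Circuit.act C (pauliX (e (.inr (.inr i)))) =
        xRow (fun q => toRat (T (.inr (.inr i)) q)) +
        ∑ a, toRat (P i a) • Circuit.act C (pauliX (e (.inl a)))) ∧
      (∀ i, Circuit.act C (pauliZ (e (.inr (.inr i)))) =
        zRow fun q => toRat (conjT T' (.inr (.inr i)) q)) ∧
      ((∀ a, ∃ m, γ a = LaurentPolynomial.T m) → Circuit.FiniteDepth C) := by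
  obtain ⟨C₁, h₁, h₂, h₃, h₄, h₅, h₆, hfd⟩ := exists_precoder (a₁ := a₁) (a₂ := a₂) γ hγ P
  obtain ⟨C₂, hfd₂, hC₂⟩ := exists_circuit_of_mul_eq_one
    (M := T.submatrix e.symm id) (N := T'.submatrix id e.symm) (by
      rw [← Matrix.submatrix_mul _ _ _ _ _ Function.bijective_id, hTT',
        Matrix.submatrix_one_equiv])
  have hact : ∀ u : PauliRow (SenderQubits c a₁ a₂ k),
      Circuit.act (Circuit.map e.toEmbedding C₁ ++ C₂) (fun s => u (Sum.map e.symm e.symm s)) =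
        Circuit.act C₂ (fun s => Circuit.act C₁ u (Sum.map e.symm e.symm s)) := by
    intro u
    rw [Circuit.act_append, act_map_equiv]
  have hZ : ∀ q, pauliZ (e q) = fun s => pauliZ q (Sum.map e.symm e.symm s) := by
    intro q
    funext s
    rcases s with s | s <;> simp [pauliZ, Pi.single_apply, Equiv.symm_apply_eq]
  have hX : ∀ q, pauliX (e q) = fun s => pauliX q (Sum.map e.symm e.symm s) := by
    intro q
    funext s
    rcases s with s | s <;> simp [pauliX, Pi.single_apply, Equiv.symm_apply_eq]
  have hTz : ∀ y : SenderQubits c a₁ a₂ k → BRat,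
      Circuit.act C₂ (fun s => zRow y (Sum.map e.symm e.symm s)) =
        zRow (Matrix.vecMul y ((conjT T').map toRat)) := by
    intro y
    have : (fun s => zRow y (Sum.map e.symm e.symm s)) = zRow fun q => y (e.symm q) := by
      funext s
      rcases s with s | s <;> simp [zRow]
    rw [this, hC₂, cssAct_zRow]
    congr 1
    funext j
    exact e.symm.sum_comp (fun q => y q * ((conjT T').map toRat) q j)
  have hTx : ∀ y : SenderQubits c a₁ a₂ k → BRat,
      Circuit.act C₂ (fun s => xRow y (Sum.map e.symm e.symm s)) =
        xRow (Matrix.vecMul y (T.map toRat)) := by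
    intro y
    have : (fun s => xRow y (Sum.map e.symm e.symm s)) = xRow fun q => y (e.symm q) := by
      funext s
      rcases s with s | s <;> simp [xRow]
    rw [this, hC₂, cssAct_xRow]
    congr 1
    funext j
    exact e.symm.sum_comp (fun q => y q * (T.map toRat) q j)
  -- `conjT T'` is the action of `T` on `Z` parts; it returns from dual coordinates to `H₁` itself.
  have hH₁ : H₁ * conjT T * conjT T' = H₁ := by
    rw [Matrix.mul_assoc, ← conjT_mul, hT'T, conjT_one, Matrix.mul_one]
  have hrow : ∀ i, Matrix.vecMul ((H₁ * conjT T) i) (conjT T') = H₁ i := by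
    intro i
    rw [← Matrix.mul_apply_eq_vecMul, hH₁]
  refine ⟨Circuit.map e.toEmbedding C₁ ++ C₂, ?_, ?_, ?_, ?_, ?_, ?_, fun h =>
    ((hfd h).map _).append hfd₂⟩
  · intro a
    rw [hZ, hact, h₁, hTz, ← hH, vecMul_map_toRat, hrow]
  · intro b
    rw [hZ, hact, h₂, hTz]
    have : (Pi.single (.inr (.inl (.inl b))) 1 : SenderQubits c a₁ a₂ k → BRat) =
        fun q => toRat ((H₁ * conjT T) (.inr b) q) := by
      funext q
      rw [hz]
      simp [Pi.single_apply, apply_ite toRat]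
    rw [this, vecMul_map_toRat, hrow]
  · intro a
    rw [hX, hact, h₃, hTx, Matrix.smul_vecMul, Matrix.single_one_vecMul]
    have h0 : toRat (LaurentPolynomial.invert (γ a)) ≠ 0 := fun h => hγ a (by
      have := toRat_injective (h.trans (map_zero toRat).symm)
      simpa using this)
    funext t
    rcases t with t | t
    · simp [xRow]
    · simp [xRow, Matrix.row, mul_inv_cancel_left₀ h0, hc]
  · intro b
    rw [hZ, hact, h₄, hTx, Matrix.single_one_vecMul]
    congr 1
    funext q
    simp [Matrix.row, hx]
  · intro i
    simp only [hX, hact]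
    rw [h₅]
    have hsplit : (fun s => (xRow (Pi.single (.inr (.inr i)) 1) +
        ∑ a, toRat (P i a) • Circuit.act C₁ (pauliX (.inl a)) : PauliRow (SenderQubits c a₁ a₂ k))
          (Sum.map e.symm e.symm s)) =
        (fun s => xRow (Pi.single (.inr (.inr i)) 1) (Sum.map e.symm e.symm s)) +
        ∑ a, toRat (P i a) • fun s => Circuit.act C₁ (pauliX (.inl a)) (Sum.map e.symm e.symm s) := by
      funext s
      simp [Finset.sum_apply]
    rw [hsplit, Circuit.act_add, hTx, Matrix.single_one_vecMul, Circuit.act_sum]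
    simp only [Circuit.act_smul]
    rfl
  · intro i
    rw [hZ, hact, h₆, hTz, Matrix.single_one_vecMul]
    rfl

/-- Only `T` and `P` have to be undone, and both have Laurent polynomial entries: the scaling by `γ`
has already been absorbed into the stabilizer. -/
theorem exists_decoder (e : SenderQubits c a₁ a₂ k ≃ Fin n)
    {T : Matrix (SenderQubits c a₁ a₂ k) (Fin n) BLaurent}
    {T' : Matrix (Fin n) (SenderQubits c a₁ a₂ k) BLaurent} (P : Matrix (Fin k) (Fin c) BLaurent)
    (hTT' : T * T' = 1) (hT'T : T' * T = 1) :
    ∃ C : Circuit (FrameQubits n c), Circuit.FiniteDepth C ∧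
      (∀ i, Circuit.act C (joinRow (xRow fun a => toRat (P i a))
        (xRow fun q => toRat (T (.inr (.inr i)) q))) = pauliX (.inr (e (.inr (.inr i))))) ∧
      (∀ i, Circuit.act C (joinRow 0 (zRow fun q => toRat (conjT T' (.inr (.inr i)) q))) =
        pauliZ (.inr (e (.inr (.inr i))))) := by
  obtain ⟨C₁, hfd₁, hC₁⟩ := exists_circuit_of_mul_eq_one
    (M := T'.submatrix id e.symm) (N := T.submatrix e.symm id) (by
      rw [Matrix.submatrix_mul_equiv, hT'T, Matrix.submatrix_id_id])
  -- CNOTs from the restored information qubits cancel `P` on the receiver's halves. They leave the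
  -- information `Z` alone, because they only change the `Z` parts of their targets' controls.
  let F : Matrix (Fin n) (Fin c) BLaurent :=
    Matrix.of fun q a => (Sum.elim 0 (Sum.elim 0 fun i => P i a) :
      SenderQubits c a₁ a₂ k → BLaurent) (e.symm q)
  obtain ⟨C₂, hfd₂, hC₂⟩ := exists_circuit_of_mul_eq_one (lowerShear_mul_self F)
  refine ⟨Circuit.map Function.Embedding.inr C₁ ++ C₂, (hfd₁.map _).append hfd₂, ?_, ?_⟩
  · intro i
    have h : Matrix.vecMul (T (.inr (.inr i))) (T'.submatrix id e.symm) =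
        Pi.single (e (.inr (.inr i))) 1 := by
      funext j
      have := congrFun (congrFun hTT' (.inr (.inr i))) (e.symm j)
      refine this.trans ?_
      simp [Matrix.one_apply, Pi.single_apply, Equiv.eq_symm_apply, eq_comm]
    rw [Circuit.act_append, act_map_joinRow, hC₁, cssAct_xRow, vecMul_map_toRat, h, hC₂]
    have : joinRow (xRow fun a => toRat (P i a)) (xRow fun j => toRat
        ((Pi.single (e (.inr (.inr i))) 1 : Fin n → BLaurent) j)) =
        xRow fun q => toRat ((Sum.elim (P i) (Pi.single (e (.inr (.inr i))) 1) :
          FrameQubits n c → BLaurent) q) := by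
      funext s
      rcases s with (s | s) | (s | s) <;> simp [joinRow, xRow]
    rw [this, cssAct_xRow, vecMul_map_toRat, pauliX_eq_xRow]
    congr 1
    funext q
    rw [lowerShear, Matrix.vecMul_fromBlocks]
    rcases q with q | q
    · simp [Matrix.row, F, CharTwo.add_self_eq_zero]
    · simp [Pi.single_apply, apply_ite toRat]
  · intro i
    have h : Matrix.vecMul (conjT T' (.inr (.inr i))) (conjT (T.submatrix e.symm id)) =
        Pi.single (e (.inr (.inr i))) 1 := by
      funext j
      have h1 : conjT T' * conjT T = 1 := by rw [← conjT_mul, hTT', conjT_one]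
      have := congrFun (congrFun h1 (.inr (.inr i))) (e.symm j)
      refine this.trans ?_
      simp [Matrix.one_apply, Pi.single_apply, Equiv.eq_symm_apply, eq_comm]
    rw [Circuit.act_append, act_map_joinRow, hC₁, cssAct_zRow, vecMul_map_toRat, h, hC₂]
    have : joinRow 0 (zRow fun j => toRat
        ((Pi.single (e (.inr (.inr i))) 1 : Fin n → BLaurent) j)) =
        zRow fun q => toRat ((Sum.elim 0 (Pi.single (e (.inr (.inr i))) 1) :
          FrameQubits n c → BLaurent) q) := by
      funext s
      rcases s with (s | s) | (s | s) <;> simp [joinRow, zRow, Pi.single_apply]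
    rw [this, cssAct_zRow, vecMul_map_toRat, pauliZ_eq_zRow, conjT_lowerShear]
    congr 1
    funext q
    rw [Matrix.vecMul_fromBlocks, Sum.elim_comp_inl, Sum.elim_comp_inr]
    rcases q with q | q
    · simp
    · simp [Pi.single_apply, apply_ite toRat]

end Frame

/-! ### Assembly of the code and realization of the check matrix -/

theorem joinRow_pauliZ {Q Q' : Type} [DecidableEq Q] [DecidableEq Q'] (q : Q) (q' : Q') :
    joinRow (pauliZ q) (pauliZ q') = pauliZ (.inl q) + pauliZ (.inr q') := by
  funext s
  rcases s with (s | s) | (s | s) <;> simp [joinRow, pauliZ, Pi.single_apply]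

theorem joinRow_pauliX {Q Q' : Type} [DecidableEq Q] [DecidableEq Q'] (q : Q) (q' : Q') :
    joinRow (pauliX q) (pauliX q') = pauliX (.inl q) + pauliX (.inr q') := by
  funext s
  rcases s with (s | s) | (s | s) <;> simp [joinRow, pauliX, Pi.single_apply]

theorem joinRow_zero_pauliZ {Q Q' : Type} [DecidableEq Q] [DecidableEq Q'] (q' : Q') :
    joinRow (0 : PauliRow Q) (pauliZ q') = pauliZ (.inr q') := by
  funext s
  rcases s with (s | s) | (s | s) <;> simp [joinRow, pauliZ, Pi.single_apply]

theorem joinRow_zero_pauliX {Q Q' : Type} [DecidableEq Q] [DecidableEq Q'] (q' : Q') :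
    joinRow (0 : PauliRow Q) (pauliX q') = pauliX (.inr q') := by
  funext s
  rcases s with (s | s) | (s | s) <;> simp [joinRow, pauliX, Pi.single_apply]

theorem shiftedSymp_swap {Q : Type} [Fintype Q] (u v : Q ⊕ Q → BLaurent) :
    shiftedSymp u v = LaurentPolynomial.invert (shiftedSymp v u) := by
  simp only [shiftedSymp, map_sum, map_add, map_mul, invert_invert]
  refine Finset.sum_congr rfl fun q _ => ?_
  ring

/-- The rows of `[H₁ 0 | 0 H₂]` extended by `Z`-type and `X`-type sequences on further qubits. -/
noncomputable def extendedRows {ι₁ ι₂ α ν : Type} (E₁ : Matrix ι₁ α BLaurent)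
    (H₁ : Matrix ι₁ ν BLaurent) (E₂ : Matrix ι₂ α BLaurent) (H₂ : Matrix ι₂ ν BLaurent) :
    ι₁ ⊕ ι₂ → (α ⊕ ν) ⊕ (α ⊕ ν) → BLaurent
  | .inl i => Sum.elim (Sum.elim (E₁ i) (H₁ i)) 0
  | .inr i => Sum.elim 0 (Sum.elim (E₂ i) (H₂ i))

/-- The overlap on the receiver's qubits cancels that on the sender's qubits in characteristic two;
rows of equal type commute trivially. -/
theorem shiftedSymp_extendedRows {ι₁ ι₂ α ν : Type} [Fintype α] [Fintype ν]
    {E₁ : Matrix ι₁ α BLaurent} {H₁ : Matrix ι₁ ν BLaurent} {E₂ : Matrix ι₂ α BLaurent}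
    {H₂ : Matrix ι₂ ν BLaurent} (h : E₁ * conjT E₂ = H₁ * conjT H₂) (i j : ι₁ ⊕ ι₂) :
    shiftedSymp (extendedRows E₁ H₁ E₂ H₂ i) (extendedRows E₁ H₁ E₂ H₂ j) = 0 := by
  have key : ∀ i j, shiftedSymp (extendedRows E₁ H₁ E₂ H₂ (.inl i))
      (extendedRows E₁ H₁ E₂ H₂ (.inr j)) = 0 := by
    intro i j
    have h1 : shiftedSymp (extendedRows E₁ H₁ E₂ H₂ (.inl i))
        (extendedRows E₁ H₁ E₂ H₂ (.inr j)) = (E₁ * conjT E₂) i j + (H₁ * conjT H₂) i j := by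
      simp [shiftedSymp, extendedRows, Matrix.mul_apply, conjT_apply]
    rw [h1, h, CharTwo.add_self_eq_zero]
  rcases i with i | i <;> rcases j with j | j
  · simp [shiftedSymp, extendedRows]
  · exact key i j
  · rw [shiftedSymp_swap, key, map_zero]
  · simp [shiftedSymp, extendedRows]

/-- The layout of the sender's frame with two kinds of ancilla qubits. -/
def layoutOf {n k c a₁ a₂ : ℕ} (w : Fin (n - k - c) ≃ Fin a₁ ⊕ Fin a₂)
    (e : SenderQubits c a₁ a₂ k ≃ Fin n) : Layout n k c :=
  (Equiv.sumCongr (Equiv.refl _) (Equiv.sumCongr w (Equiv.refl _))).trans e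

/-- Groups the stabilizer generators into those for the `Z`-type and for the `X`-type checks. -/
def stabEquiv {n k c a₁ a₂ : ℕ} (w : Fin (n - k - c) ≃ Fin a₁ ⊕ Fin a₂) :
    StabIndex n k c ≃ (Fin c ⊕ Fin a₁) ⊕ (Fin c ⊕ Fin a₂) :=
  (Equiv.sumCongr (Equiv.refl _) w).trans (Equiv.sumSumSumComm _ _ _ _)

theorem exists_code_of_frame {n k c a₁ a₂ r₁ r₂ : ℕ}
    (w : Fin (n - k - c) ≃ Fin a₁ ⊕ Fin a₂) (e : SenderQubits c a₁ a₂ k ≃ Fin n)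
    {γ : Fin c → BLaurent} (hγ : ∀ a, γ a ≠ 0)
    {H₁ : Matrix (Fin c ⊕ Fin a₁) (Fin n) BLaurent}
    {H₂ : Matrix (Fin c ⊕ Fin a₂) (Fin n) BLaurent}
    (hΔ : H₁ * conjT H₂ = Matrix.fromBlocks (Matrix.diagonal γ) 0 0 0)
    {T : Matrix (SenderQubits c a₁ a₂ k) (Fin n) BLaurent}
    {T' : Matrix (Fin n) (SenderQubits c a₁ a₂ k) BLaurent} {P : Matrix (Fin k) (Fin c) BLaurent}
    (hTT' : T * T' = 1) (hT'T : T' * T = 1)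
    (hc : ∀ a, T (.inl a) = H₂ (.inl a)) (hx : ∀ b, T (.inr (.inl (.inr b))) = H₂ (.inr b))
    (hH : ∀ a, (H₁ * conjT T) (.inl a) = Sum.elim (Pi.single a (γ a)) (Sum.elim 0 (conjT P a)))
    (hz : ∀ b, (H₁ * conjT T) (.inr b) = Pi.single (.inr (.inl (.inl b))) 1)
    {A : Matrix (Fin r₁) (Fin c ⊕ Fin a₁) BLaurent} {A' : Matrix (Fin c ⊕ Fin a₁) (Fin r₁) BLaurent}
    (hAA' : A * A' = 1) (hA'A : A' * A = 1)
    {B : Matrix (Fin r₂) (Fin c ⊕ Fin a₂) BLaurent} {B' : Matrix (Fin c ⊕ Fin a₂) (Fin r₂) BLaurent}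
    (hBB' : B * B' = 1) (hB'B : B' * B = 1) :
    ∃ C : Code n k c, C.Realizes (Matrix.fromBlocks (A * H₁) 0 0 (B * H₂)) ∧
      ((∀ a, ∃ m, γ a = LaurentPolynomial.T m) → C.encoder.FiniteDepth) := by
  obtain ⟨E, hE₁, hE₂, hE₃, hE₄, hE₅, hE₆, hfd⟩ := exists_encoder e hγ hTT' hT'T hc hx hH hz
  obtain ⟨D, hD, hDX, hDZ⟩ := exists_decoder e P hTT' hT'T
  let enc : Circuit (FrameQubits n c) := Circuit.map Function.Embedding.inr E
  have henc : ∀ u v, Circuit.act enc (joinRow u v) = joinRow u (Circuit.act E v) :=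
    act_map_joinRow E
  let L : Layout n k c := layoutOf w e
  have hS₁ : ∀ a, Circuit.act enc (initialStabilizer L (.inl (.inl a))) =
      joinRow (pauliZ a) (zRow fun q => toRat (H₁ (.inl a) q)) := by
    intro a
    rw [← hE₁, ← henc, joinRow_pauliZ]; rfl
  have hS₂ : ∀ a, Circuit.act enc (initialStabilizer L (.inl (.inr a))) =
      joinRow (pauliX a) (Circuit.act E (pauliX (e (.inl a)))) := by
    intro a
    rw [← henc, joinRow_pauliX]; rfl
  have hS₃ : ∀ b, Circuit.act enc (initialStabilizer L (.inr (w.symm (.inl b)))) =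
      joinRow 0 (zRow fun q => toRat (H₁ (.inr b) q)) := by
    intro b
    rw [← hE₂, ← henc, joinRow_zero_pauliZ]
    simp [initialStabilizer, L, layoutOf]
  have hS₄ : ∀ b, Circuit.act enc (initialStabilizer L (.inr (w.symm (.inr b)))) =
      joinRow 0 (xRow fun q => toRat (H₂ (.inr b) q)) := by
    intro b
    rw [← hE₄, ← henc, joinRow_zero_pauliZ]
    simp [initialStabilizer, L, layoutOf]
  let C : Code n k c :=
    { layout := L
      encoder := enc
      encoder_local := Circuit.qubits_map Function.Embedding.inr E
      decoder := D
      decoder_finiteDepth := hD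
      output := ⟨fun i => .inr (e (.inr (.inr i))), fun i j h => by simpa using h⟩
      decodes_Z := fun i => ⟨0, by
        have h : pauliZ (infoQubit L i) = joinRow 0 (pauliZ (e (.inr (.inr i)))) := by
          rw [joinRow_zero_pauliZ]; rfl
        rw [h, henc, hE₆, hDZ]
        simp
        rfl⟩
      decodes_X := fun i => ⟨Sum.elim (Sum.elim 0 (P i)) 0, by
        have h : pauliX (infoQubit L i) = joinRow 0 (pauliX (e (.inr (.inr i)))) := by
          rw [joinRow_zero_pauliX]; rfl
        -- Adding `P` times `X` twice on the receiver's halves changes nothing. One copy completes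
        -- the infinite-weight part to multiples of the generators `XX`, and the other joins the row
        -- of `T`, as the decoder expects.
        have h0 : (0 : PauliRow (Fin c)) = xRow (fun a => toRat (P i a)) +
            ∑ a, toRat (P i a) • pauliX a := by
          funext s
          rcases s with s | s
          · simp [xRow, pauliX, Finset.sum_apply]
          · simp [xRow, pauliX, Finset.sum_apply, Pi.single_apply, CharTwo.add_self_eq_zero]
        rw [h, henc, hE₅, h0, joinRow_add, joinRow_sum, Circuit.act_add, hDX, Circuit.act_sum]
        simp only [joinRow_smul, Circuit.act_smul, ← hS₂]
        simp [Fintype.sum_sum_type]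
        rfl⟩ }
  refine ⟨C, ?_, fun h => (hfd h).map _⟩
  let σ := stabEquiv (n := n) (k := k) (c := c) w
  let U : Matrix (Fin r₁ ⊕ Fin r₂) ((Fin c ⊕ Fin a₁) ⊕ (Fin c ⊕ Fin a₂)) BLaurent :=
    Matrix.fromBlocks A 0 0 B
  let U' : Matrix ((Fin c ⊕ Fin a₁) ⊕ (Fin c ⊕ Fin a₂)) (Fin r₁ ⊕ Fin r₂) BLaurent :=
    Matrix.fromBlocks A' 0 0 B'
  have hUU' : U * U' = 1 := by simp [U, U', Matrix.fromBlocks_multiply, hAA', hBB']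
  have hU'U : U' * U = 1 := by simp [U, U', Matrix.fromBlocks_multiply, hA'A, hB'B]
  -- The ebit generators of `X` type have to be multiplied by `γ_a(D⁻¹)` to get finite weight. This
  -- factor makes the row operation invertible over the rational functions only.
  let δ : (Fin c ⊕ Fin a₁) ⊕ (Fin c ⊕ Fin a₂) → BLaurent :=
    Sum.elim 1 (Sum.elim (fun a => LaurentPolynomial.invert (γ a)) 1)
  have hδ : ∀ t, toRat (δ t) ≠ 0 := by
    intro t h
    have h' : δ t = 0 := toRat_injective (h.trans (map_zero toRat).symm)
    rcases t with t | (t | t)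
    · exact one_ne_zero h'
    · exact hγ t (by simpa [δ] using h')
    · exact one_ne_zero h'
  let V : Matrix (Fin r₁ ⊕ Fin r₂) ((Fin c ⊕ Fin a₁) ⊕ (Fin c ⊕ Fin a₂)) BLaurent :=
    U * Matrix.diagonal δ
  let V' : Matrix ((Fin c ⊕ Fin a₁) ⊕ (Fin c ⊕ Fin a₂)) (Fin r₁ ⊕ Fin r₂) BRat :=
    Matrix.diagonal (fun t => (toRat (δ t))⁻¹) * U'.map toRat
  have hdd : Matrix.diagonal (fun t => toRat (δ t)) *
      Matrix.diagonal (fun t => (toRat (δ t))⁻¹) = 1 := by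
    rw [Matrix.diagonal_mul_diagonal, ← Matrix.diagonal_one]
    congr 1; funext t; exact mul_inv_cancel₀ (hδ t)
  have hdd' : Matrix.diagonal (fun t => (toRat (δ t))⁻¹) *
      Matrix.diagonal (fun t => toRat (δ t)) = 1 := by
    rw [Matrix.diagonal_mul_diagonal, ← Matrix.diagonal_one]
    congr 1; funext t; exact inv_mul_cancel₀ (hδ t)
  have hVmap : V.map toRat = U.map toRat * Matrix.diagonal (fun t => toRat (δ t)) := by
    rw [Matrix.map_mul, Matrix.diagonal_map (map_zero _)]
  have hVV' : V.map toRat * V' = 1 := by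
    rw [hVmap, Matrix.mul_assoc, ← Matrix.mul_assoc (Matrix.diagonal _), hdd, Matrix.one_mul,
      ← Matrix.map_mul, hUU', Matrix.map_one _ (map_zero _) (map_one _)]
  have hV'V : V' * V.map toRat = 1 := by
    rw [hVmap, Matrix.mul_assoc, ← Matrix.mul_assoc (U'.map _), ← Matrix.map_mul, hU'U,
      Matrix.map_one _ (map_zero _) (map_one _), Matrix.one_mul, hdd']
  -- The receiver's parts follow from the same row operations: `A` on the ebit `Z`, and `B` with the
  -- factor `γ_a(D⁻¹)` on the ebit `X`.
  let E₁ : Matrix (Fin r₁) (Fin c) BLaurent := A.submatrix id Sum.inl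
  let E₂ : Matrix (Fin r₂) (Fin c) BLaurent :=
    Matrix.of fun j a => B j (.inl a) * LaurentPolynomial.invert (γ a)
  refine ⟨extendedRows E₁ (A * H₁) E₂ (B * H₂), V.submatrix id σ, V'.submatrix σ id, ?_, ?_, ?_, ?_,
    ?_⟩
  · rintro (i | i) <;> funext q <;> rcases q with q | q <;> rfl
  · refine shiftedSymp_extendedRows ?_
    rw [conjT_mul, Matrix.mul_assoc, ← Matrix.mul_assoc H₁, hΔ]
    ext1 i j
    simp [Matrix.mul_apply, E₁, E₂, conjT_apply, Fintype.sum_sum_type, Matrix.diagonal_apply,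
      mul_comm, mul_left_comm, invert_invert]
  · change (V.map toRat).submatrix id σ * V'.submatrix σ id = 1
    rw [Matrix.submatrix_mul_equiv, hVV', Matrix.submatrix_id_id]
  · change V'.submatrix σ id * (V.map toRat).submatrix id σ = 1
    rw [← Matrix.submatrix_mul _ _ _ _ _ Function.bijective_id, hV'V, Matrix.submatrix_one_equiv]
  · intro i
    have hsum : ∑ s, toRat (V.submatrix id σ i s) • C.stabilizer s =
        ∑ t, toRat (V i t) • C.stabilizer (σ.symm t) := by
      rw [← σ.sum_comp]
      simp
    have hV : ∀ i t, V i t = U i t * δ t := fun i t => Matrix.mul_diagonal ..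
    have hσ₁ : ∀ a, C.stabilizer (σ.symm (.inl (.inl a))) = _ := hS₁
    have hσ₂ : ∀ a, C.stabilizer (σ.symm (.inr (.inl a))) = _ := hS₂
    have hσ₃ : ∀ b, C.stabilizer (σ.symm (.inl (.inr b))) = _ := hS₃
    have hσ₄ : ∀ b, C.stabilizer (σ.symm (.inr (.inr b))) = _ := hS₄
    rw [hsum, Fintype.sum_sum_type, Fintype.sum_sum_type, Fintype.sum_sum_type]
    simp only [hσ₁, hσ₂, hσ₃, hσ₄, hV]
    rcases i with i | i
    · simp only [U, δ, Matrix.fromBlocks_apply₁₁, Matrix.fromBlocks_apply₁₂, Matrix.zero_apply,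
        zero_mul, map_zero, zero_smul, Finset.sum_const_zero, add_zero, Sum.elim_inl, Pi.one_apply,
        mul_one]
      funext s
      rcases s with (s | s) | (s | s)
      · simp [extendedRows, joinRow, E₁, pauliZ, Finset.sum_apply, Pi.single_apply]
      · simp [extendedRows, joinRow, zRow, Finset.sum_apply, Matrix.mul_apply,
          Fintype.sum_sum_type]
      · simp [extendedRows, joinRow, pauliZ, Finset.sum_apply]
      · simp [extendedRows, joinRow, zRow, Finset.sum_apply]
    · have hsm : ∀ a, toRat (B i (.inl a) * LaurentPolynomial.invert (γ a)) •
          joinRow (pauliX a) (Circuit.act E (pauliX (e (.inl a)))) =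
          joinRow (toRat (B i (.inl a) * LaurentPolynomial.invert (γ a)) • pauliX a)
            (toRat (B i (.inl a)) • xRow fun q => toRat (H₂ (.inl a) q)) := by
        intro a
        rw [← joinRow_smul, map_mul, mul_smul _ _ (Circuit.act _ _), hE₃]
      simp only [U, δ, Matrix.fromBlocks_apply₂₁, Matrix.fromBlocks_apply₂₂, Matrix.zero_apply,
        map_zero, zero_smul, Finset.sum_const_zero, zero_add, Sum.elim_inl, Sum.elim_inr,
        Pi.one_apply, mul_one, hsm]
      funext s
      rcases s with (s | s) | (s | s)
      · simp [extendedRows, joinRow, pauliX, Finset.sum_apply]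
      · simp [extendedRows, joinRow, xRow, Finset.sum_apply]
      · simp [extendedRows, joinRow, E₂, pauliX, Finset.sum_apply, Pi.single_apply]
      · simp [extendedRows, joinRow, xRow, Finset.sum_apply, Matrix.mul_apply,
          Fintype.sum_sum_type]

/-- Passing to `A⁻¹ H₁` and `(B⁻¹)† H₂` makes the overlap diagonal. The code built for these rows
also realizes the original ones, since `A` and `B†` enter the row operation `R`. -/
theorem exists_code {n c a₁ a₂ r₁ r₂ : ℕ} {H₁ : Matrix (Fin r₁) (Fin n) BLaurent}
    {K₁ : Matrix (Fin n) (Fin r₁) BLaurent} (hK₁ : H₁ * K₁ = 1)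
    {H₂ : Matrix (Fin r₂) (Fin n) BLaurent} {K₂ : Matrix (Fin n) (Fin r₂) BLaurent}
    (hK₂ : H₂ * K₂ = 1) {γ : Fin c → BLaurent} (hγ : ∀ a, γ a ≠ 0)
    {A : Matrix (Fin r₁) (Fin c ⊕ Fin a₁) BLaurent} {A' : Matrix (Fin c ⊕ Fin a₁) (Fin r₁) BLaurent}
    (hAA' : A * A' = 1) (hA'A : A' * A = 1)
    {B : Matrix (Fin c ⊕ Fin a₂) (Fin r₂) BLaurent} {B' : Matrix (Fin r₂) (Fin c ⊕ Fin a₂) BLaurent}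
    (hBB' : B * B' = 1) (hB'B : B' * B = 1)
    (hH : H₁ * conjT H₂ = A * (Matrix.fromBlocks (Matrix.diagonal γ) 0 0 0 :
      Matrix (Fin c ⊕ Fin a₁) (Fin c ⊕ Fin a₂) BLaurent) * B) :
    c + a₁ + a₂ ≤ n ∧ ∀ k, c + a₁ + a₂ + k = n → ∃ C : Code n k c,
      C.Realizes (Matrix.fromBlocks H₁ 0 0 H₂) ∧
      ((∀ a, ∃ m, γ a = LaurentPolynomial.T m) → C.encoder.FiniteDepth) := by
  have hΔ : A' * H₁ * conjT (conjT B' * H₂) =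
      Matrix.fromBlocks (Matrix.diagonal γ) 0 0 0 := by
    rw [conjT_mul, conjT_conjT, Matrix.mul_assoc, ← Matrix.mul_assoc H₁, hH,
      Matrix.mul_assoc _ B, hBB', Matrix.mul_one, ← Matrix.mul_assoc, hA'A, Matrix.one_mul]
  have hcB : conjT B * conjT B' = 1 := by rw [← conjT_mul, hB'B, conjT_one]
  have hcB' : conjT B' * conjT B = 1 := by rw [← conjT_mul, hBB', conjT_one]
  obtain ⟨k, T, T', P, hk, hTT', hT'T, hc, hx, hHT, hz⟩ := exists_frame_matrix (A' * H₁) (K₁ * A)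
    (conjT B' * H₂) (K₂ * conjT B)
    (by rw [Matrix.mul_assoc, ← Matrix.mul_assoc H₁, hK₁, Matrix.one_mul, hA'A])
    (by rw [Matrix.mul_assoc, ← Matrix.mul_assoc H₂, hK₂, Matrix.one_mul, hcB']) γ hΔ
  -- The completion exists for some `k ≥ 0`, which gives the inequality; the count then determines
  -- `k`.
  refine ⟨by omega, fun k' hk' => ?_⟩
  obtain rfl : k' = k := by omega
  let w : Fin (n - k' - c) ≃ Fin a₁ ⊕ Fin a₂ := Fintype.equivOfCardEq (by simp; omega)
  let e : SenderQubits c a₁ a₂ k' ≃ Fin n := Fintype.equivOfCardEq (by simp; omega)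
  have h := exists_code_of_frame w e hγ hΔ hTT' hT'T hc hx hHT hz hAA' hA'A hcB hcB'
  rwa [← Matrix.mul_assoc, ← Matrix.mul_assoc, hAA', hcB, Matrix.one_mul, Matrix.one_mul] at h

/-- The factorization is left arbitrary, so that the same construction serves for a computed Smith
form and for a given monomial one. -/
theorem exists_code_of_smith {n c r₁ r₂ : ℕ} {H₁ : Matrix (Fin r₁) (Fin n) (ZMod 2)[X]}
    {H₂ : Matrix (Fin r₂) (Fin n) (ZMod 2)[X]} (h₁ : Noncatastrophic H₁) (h₂ : Noncatastrophic H₂)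
    {A : Matrix (Fin r₁) (Fin r₁) BLaurent} {B : Matrix (Fin r₂) (Fin r₂) BLaurent}
    (hA : IsUnit A) (hB : IsUnit B) (hc₁ : c ≤ r₁) (hc₂ : c ≤ r₂) {d : ℕ → BLaurent}
    (hd : ∀ i < c, d i ≠ 0) (h : overlap H₁ H₂ = A * partialDiagonal r₁ r₂ c d * B) :
    r₁ + r₂ ≤ n + c ∧ ∀ k, r₁ + r₂ + k = n + c → ∃ C : Code n k c,
      C.Realizes (cssCheckMatrix H₁ H₂) ∧
      ((∀ i < c, ∃ m, d i = LaurentPolynomial.T m) → C.encoder.FiniteDepth) := by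
  obtain ⟨K₁, hK₁⟩ := h₁.exists_right_inverse
  obtain ⟨K₂, hK₂⟩ := h₂.exists_right_inverse
  obtain ⟨a₁, rfl⟩ := Nat.exists_eq_add_of_le hc₁
  obtain ⟨a₂, rfl⟩ := Nat.exists_eq_add_of_le hc₂
  obtain ⟨A', hAA', hA'A⟩ := isUnit_iff_exists.mp hA
  obtain ⟨B', hBB', hB'B⟩ := isUnit_iff_exists.mp hB
  let e₁ : Fin c ⊕ Fin a₁ ≃ Fin (c + a₁) := finSumFinEquiv
  let e₂ : Fin c ⊕ Fin a₂ ≃ Fin (c + a₂) := finSumFinEquiv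
  have hpd : (partialDiagonal (c + a₁) (c + a₂) c d).submatrix e₁ e₂ =
      Matrix.fromBlocks (Matrix.diagonal fun a : Fin c => d a) 0 0 0 := by
    ext1 i j
    rcases i with i | i <;> rcases j with j | j
    · simp [e₁, e₂, partialDiagonal, Matrix.diagonal_apply, Fin.ext_iff]
    · have : i.val ≠ c + j.val := by omega
      simp [e₁, e₂, partialDiagonal, this]
    · simp [e₁, e₂, partialDiagonal]
    · simp [e₁, e₂, partialDiagonal]
  obtain ⟨hle, hex⟩ := exists_code (a₁ := a₁) (a₂ := a₂) hK₁ hK₂ (γ := fun a : Fin c => d a)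
    (fun a => hd a a.isLt) (A := A.submatrix id e₁) (A' := A'.submatrix e₁ id)
    (B := B.submatrix e₂ id) (B' := B'.submatrix id e₂)
    (by rw [Matrix.submatrix_mul_equiv, hAA', Matrix.submatrix_id_id])
    (by rw [← Matrix.submatrix_mul _ _ _ _ _ Function.bijective_id, hA'A,
      Matrix.submatrix_one_equiv])
    (by rw [← Matrix.submatrix_mul _ _ _ _ _ Function.bijective_id, hBB',
      Matrix.submatrix_one_equiv])
    (by rw [Matrix.submatrix_mul_equiv, hB'B, Matrix.submatrix_id_id])
    (by
      rw [← hpd, Matrix.submatrix_mul_equiv, Matrix.submatrix_mul_equiv, Matrix.submatrix_id_id]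
      exact h)
  refine ⟨by omega, fun k hk => ?_⟩
  obtain ⟨C, hC, hfd⟩ := hex k (by omega)
  exact ⟨C, hC, fun h => hfd fun a => h a a.isLt⟩

end EAQC

theorem mainTheorem1 (n k₁ k₂ : ℕ) (hk₁ : k₁ ≤ n) (hk₂ : k₂ ≤ n)
    (H₁ : Matrix (Fin (n - k₁)) (Fin n) (ZMod 2)[X])
    (H₂ : Matrix (Fin (n - k₂)) (Fin n) (ZMod 2)[X])
    (hnc₁ : EAQC.Noncatastrophic H₁) (hdf₁ : EAQC.DelayFree H₁)
    (hnc₂ : EAQC.Noncatastrophic H₂) (hdf₂ : EAQC.DelayFree H₂)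
    (c : ℕ) (hc : c = EAQC.ratRank (EAQC.overlap H₁ H₂)) :
    n ≤ k₁ + k₂ + c ∧
    (∃ C : EAQC.Code n (k₁ + k₂ + c - n) c,
      C.Realizes (EAQC.cssCheckMatrix H₁ H₂)) ∧
    (EAQC.HasMonomialSmithForm (EAQC.overlap H₁ H₂) c →
      ∃ C : EAQC.Code n (k₁ + k₂ + c - n) c,
        C.Realizes (EAQC.cssCheckMatrix H₁ H₂) ∧ C.encoder.FiniteDepth) := by
  obtain ⟨A, B, s, d, hA, hB, hs₁, hs₂, hd, h⟩ := EAQC.exists_smith (EAQC.overlap H₁ H₂)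
  obtain rfl : c = s := by rw [hc, h, EAQC.ratRank_mul_partialDiagonal_mul hA hB hs₁ hs₂ hd]
  obtain ⟨hle, hex⟩ := EAQC.exists_code_of_smith hnc₁ hnc₂ hA hB hs₁ hs₂ hd h
  refine ⟨by omega, ?_, ?_⟩
  · obtain ⟨C, hC, -⟩ := hex (k₁ + k₂ + c - n) (by omega)
    exact ⟨C, hC⟩
  · rintro ⟨A', B', e, hA', hB', h'⟩
    -- `monomialDiagonal` unfolds to `partialDiagonal` with powers of `D` on the diagonal, so `h'`
    -- fits as it stands.
    obtain ⟨-, hex'⟩ := EAQC.exists_code_of_smith (d := fun i => LaurentPolynomial.T (e i)) hnc₁ hnc₂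
      hA' hB' hs₁ hs₂ (fun i _ => (LaurentPolynomial.isUnit_T _).ne_zero) h'
    obtain ⟨C, hC, hfd⟩ := hex' (k₁ + k₂ + c - n) (by omega)
    exact ⟨C, hC, hfd fun i _ => ⟨_, rfl⟩⟩
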